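/- Consider a stochastic $K$-armed bandit in which the reward $Y_{i,t}$ of arm $i\in\{1,\dots,K\}$ in round $t$ is drawn, independently over rounds, from a distribution $P_i$ supported in $[0,1]$ with mean $\mu_i$. Assume that arm $1$ is the unique optimal arm, $\mu_1>\mu_i$ for all $i\ge 2$, and let $\Delta_i=\mu_1-\mu_i$. Perturbed-history exploration (PHE) with an integer perturbation scale $a$ acts as follows. Let $T_{i,t-1}$ be the number of pulls of arm $i$ in the first $t-1$ rounds. In each round $t=1,2,\dots$, for every arm $i$ with $s=T_{i,t-1}>0$ it sets $$\hat\mu_{i,t}=\frac{V_{i,s}+U_{i,s}}{(a+1)s},$$ where $V_{i,s}$ is the sum of the $s$ rewards received from arm $i$ so far and $U_{i,s}$ is the sum of $as$ fresh i.i.d. $\mathrm{Ber}(1/2)$ pseudo-rewards, independent of all rewards; for every arm $i$ with $T_{i,t-1}=0$ it sets $\hat\mu_{i,t}=+\infty$. It then pulls an arm $I_t\in\arg\max_i\hat\mu_{i,t}$, with ties broken by any measurable rule that may use the past arms and rewards, the current estimates and independent randomness, and receives the reward $Y_{I_t,t}$. Let $$R(n)=\sum_{i=2}^K\Delta_i\,\mathbb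 E\Big[\sum_{t=1}^n \mathbf 1\{I_t=i\}\Big]$$ be the expected $n$-round regret. Then for every integer $a>2$ and every $n$, $$R(n)\le\sum_{i=2}^K\Delta_i\left(\frac{16ac}{\Delta_i^2}\log n+2+\frac{8a}{\Delta_i^2}\log n+3\right),$$ where $$c=\frac{e^2\sqrt{2a}}{\sqrt\pi}\exp\left[\frac{16}{a-2}\right]\left(1+\sqrt{\frac{\pi a}{8(a-2)}}\right).$$ -/

import Mathlib

open MeasureTheory ProbabilityTheory

noncomputable section

namespace PHE

/-- The interaction history of the first `t` rounds of a `K`-armed bandit: for each past round, the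
pulled arm and the reward received from it. Rounds are numbered from `0`. -/
abbrev History (K t : ℕ) : Type := Fin t → Fin K × ℝ

/-- The number of pulls of arm `i` in the history `h`. -/
def pulls {K t : ℕ} (h : History K t) (i : Fin K) : ℕ :=
  ∑ l : Fin t, if (h l).1 = i then 1 else 0

/-- The cumulative reward received from arm `i` in the history `h`. -/
def cumReward {K t : ℕ} (h : History K t) (i : Fin K) : ℝ :=
  ∑ l : Fin t, if (h l).1 = i then (h l).2 else 0

/-- The estimated rewards of the arms for the perturbation scale `a`, given the history `h` and the
pseudo-rewards `z i 0, z i 1, …` of the current round. If arm `i` was pulled `s > 0` times, it is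
the average of its `s` past rewards and of `a * s` pseudo-rewards; otherwise it is `+∞`. -/
def estimate {K t : ℕ} (a : ℕ) (h : History K t) (z : Fin K → ℕ → ℝ) (i : Fin K) : EReal :=
  if 0 < pulls h i then
    (((cumReward h i + ∑ l ∈ Finset.range (a * pulls h i), z i l) /
      (((a : ℝ) + 1) * (pulls h i : ℝ)) : ℝ) : EReal)
  else ⊤

/-- A rule that selects a maximizer of the estimated rewards. Ties are broken in any way: by the
round, the past arms and rewards, the current estimates, and an auxiliary random seed in `S`. -/
structure ArgmaxRule (K : ℕ) (S : Type*) [MeasurableSpace S] where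
  /-- The selected arm. -/
  select : ∀ t : ℕ, History K t → (Fin K → EReal) → S → Fin K
  /-- The selected arm has the highest estimate. -/
  isMax : ∀ (t : ℕ) (h : History K t) (m : Fin K → EReal) (s : S) (i : Fin K),
    m i ≤ m (select t h m s)
  /-- The selection is measurable. -/
  measurable_select : ∀ t : ℕ,
    Measurable fun p : History K t × (Fin K → EReal) × S => select t p.1 p.2.1 p.2.2

/-- The arm pulled after the history `h`, given the pseudo-rewards `z` of the current round. -/
def nextArm {K t : ℕ} {S : Type*} [MeasurableSpace S] (a : ℕ) (rule : ArgmaxRule K S) (s : S)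
    (h : History K t) (z : Fin K → ℕ → ℝ) : Fin K :=
  rule.select t h (estimate a h z) s

/-- The history generated by perturbed-history exploration in its first `t` rounds, where `y t i`
is the reward of arm `i` in round `t` and `z t i 0, z t i 1, …` are the pseudo-rewards available to
arm `i` in round `t`. -/
def history {K : ℕ} {S : Type*} [MeasurableSpace S] (a : ℕ) (rule : ArgmaxRule K S) (s : S)
    (y : ℕ → Fin K → ℝ) (z : ℕ → Fin K → ℕ → ℝ) : ∀ t : ℕ, History K t
  | 0 => Fin.elim0
  | t + 1 =>
    let h := history a rule s y z t
    let i := nextArm a rule s h (z t)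
    Fin.snoc (α := fun _ => Fin K × ℝ) h (i, y t i)

/-- The arm pulled by perturbed-history exploration in round `t`. -/
def arm {K : ℕ} {S : Type*} [MeasurableSpace S] (a : ℕ) (rule : ArgmaxRule K S) (s : S)
    (y : ℕ → Fin K → ℝ) (z : ℕ → Fin K → ℕ → ℝ) (t : ℕ) : Fin K :=
  nextArm a rule s (history a rule s y z t) (z t)

/-- The mean reward of arm `i`, where `ν i` is its reward distribution. -/
def mean {K : ℕ} (ν : Fin K → Measure ℝ) (i : Fin K) : ℝ := ∫ x, x ∂(ν i)

/-- The gap of arm `i` with respect to the optimal arm `opt`. -/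
def gap {K : ℕ} (ν : Fin K → Measure ℝ) (opt i : Fin K) : ℝ := mean ν opt - mean ν i

/-- The expected `n`-round regret of the random sequence `I` of pulled arms. -/
def regret {K : ℕ} {Ω : Type*} [MeasurableSpace Ω] (P : Measure Ω) (ν : Fin K → Measure ℝ)
    (opt : Fin K) (I : ℕ → Ω → Fin K) (n : ℕ) : ℝ :=
  ∑ i ∈ Finset.univ.erase opt,
    gap ν opt i * ∫ ω, (∑ t ∈ Finset.range n, if I t ω = i then (1 : ℝ) else 0) ∂P

/-- The Bernoulli distribution on `{0, 1} ⊆ ℝ` with mean `1 / 2`. -/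
def fairBernoulli : Measure ℝ :=
  bernoulliMeasure (1 : ℝ) 0 ⟨1 / 2, by norm_num, by norm_num⟩

/-- The constant `c` of the regret bound. -/
def boundConst (a : ℝ) : ℝ :=
  Real.exp 2 * √(2 * a) / √Real.pi * Real.exp (16 / (a - 2)) *
    (1 + √(Real.pi * a / (8 * (a - 2))))

end PHE

end

/-!
The pulls of a suboptimal arm `i` are split according to whether its estimate is below the threshold
`τ = θ / (a + 1)`, where `θ = (μ₁ + μᵢ) / 2 + a / 2` lies half-way between the expectations of the
unnormalized estimates of arm `i` and of the optimal arm.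

If the estimate is at least `τ` (`IsModel.sum_measure_above_le`), then after about
`8 a log n / Δᵢ²` pulls either the rewards or the perturbations of arm `i` deviate by `Δᵢ / 4` per
pull, which Hoeffding's inequality makes unlikely.

If the estimate is below `τ` (`IsModel.sum_measure_below_le`), then all estimates are below `τ`.
Let `q` be the conditional probability that the perturbations lift the estimate of the optimal arm
to `τ`. They are independent of everything else, so such a round is at most `q⁻¹ - 1` times as
likely as a pull of the optimal arm (`IsModel.measure_below_le`). Summing over the number `s` of
pulls of the optimal arm, it remains to bound the expectation of `q⁻¹ - 1` for the sum of `s` i.i.d.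
rewards. That rewards received at random times may be treated like this follows from a potential
function: the expected value of `f` at the sum of the first `s` rewards given the present
(`IsModel.sum_lintegral_visit_le`).

The core is the bound on the expectation of `q⁻¹`, uniform in `s` (`lintegral_inv_tail_le`).
Writing `x` for the deficit of the `s` rewards and `m = a s`, one has
`q ≥ exp (-4 (x + √(m / 12))² / m) / 16` (`le_binTail_half`), by comparison with a biased coin: the
Cauchy-Schwarz inequality bounds a probability from below by the square of its biased version over
the second moment `(1 + (2 p - 1)²) ^ m` of the likelihood ratio. On the other hand
`𝔼 exp (κ x² / s) ≤ (1 - κ / 2)^(-1/2)` for `κ < 2` (`lintegral_exp_sq_sumLaw_le`). The two combine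
with `κ = 1 + 2 / a`, which is below `2` because `a > 2`.
-/

open scoped ENNReal

namespace PHE

/-! ### Sums of i.i.d. bounded random variables -/

/-- The law of the sum of `m` independent random variables with law `ν`. -/
noncomputable def sumLaw (ν : Measure ℝ) : ℕ → Measure ℝ
  | 0 => Measure.dirac 0
  | m + 1 => ν.conv (sumLaw ν m)

instance sumLaw_isProbabilityMeasure (ν : Measure ℝ) [IsProbabilityMeasure ν] (m : ℕ) :
    IsProbabilityMeasure (sumLaw ν m) := by
  induction m with
  | zero => unfold sumLaw; infer_instance
  | succ m ih => unfold sumLaw; infer_instance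

theorem lintegral_sumLaw_succ (ν : Measure ℝ) [IsProbabilityMeasure ν] (m : ℕ)
    {f : ℝ → ℝ≥0∞} (hf : Measurable f) :
    ∫⁻ x, f x ∂(sumLaw ν (m + 1)) = ∫⁻ x, ∫⁻ y, f (x + y) ∂(sumLaw ν m) ∂ν := by
  rw [sumLaw, Measure.lintegral_conv hf]

/-- Sums of i.i.d. random variables with law `ν` have law `sumLaw ν m`. -/
theorem map_sum_eq_sumLaw {Ω : Type*} [MeasurableSpace Ω] {P : Measure Ω}
    [IsProbabilityMeasure P] {ν : Measure ℝ} [IsProbabilityMeasure ν] {W : ℕ → Ω → ℝ}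
    (hW : ∀ l, Measurable (W l)) (hlaw : ∀ l, P.map (W l) = ν) (hind : iIndepFun W P) (m : ℕ) :
    P.map (fun ω => ∑ l ∈ Finset.range m, W l ω) = sumLaw ν m := by
  induction m with
  | zero => simp [sumLaw]
  | succ m ih =>
    have h1 : IndepFun (fun ω => ∑ l ∈ Finset.range m, W l ω) (W m) P := by
      have := hind.indepFun_finsetSum_of_notMem hW (s := Finset.range m) (i := m) (by simp)
      convert this using 1
      ext ω; simp
    have h2 := h1.map_add_eq_map_conv_map₀ (by fun_prop) (hW m).aemeasurable
    rw [ih, hlaw m, Measure.conv_comm] at h2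
    rw [sumLaw, ← h2]
    congr 1
    ext ω
    simp [Finset.sum_range_succ]

theorem ae_nonneg_sumLaw {ν : Measure ℝ} [IsProbabilityMeasure ν]
    (hν : ∀ᵐ x ∂ν, x ∈ Set.Icc (0 : ℝ) 1) (m : ℕ) : ∀ᵐ x ∂(sumLaw ν m), 0 ≤ x := by
  have hmeas : MeasurableSet {x : ℝ | ¬ 0 ≤ x} := by measurability
  induction m with
  | zero => simp [sumLaw]
  | succ m ih =>
    rw [ae_iff] at ih ⊢
    rw [← lintegral_indicator_one hmeas, lintegral_sumLaw_succ ν m (by measurability),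
      lintegral_eq_zero_iff' (by
        apply Measurable.aemeasurable
        apply Measurable.lintegral_prod_right'
          (f := fun p : ℝ × ℝ => Set.indicator {x : ℝ | ¬ 0 ≤ x} (1 : ℝ → ℝ≥0∞) (p.1 + p.2))
        exact (measurable_one.indicator hmeas).comp (by fun_prop))]
    filter_upwards [hν] with x hx
    refine le_antisymm ?_ zero_le
    calc ∫⁻ y, Set.indicator {x : ℝ | ¬ 0 ≤ x} (1 : ℝ → ℝ≥0∞) (x + y) ∂(sumLaw ν m)
        ≤ ∫⁻ y, Set.indicator {x : ℝ | ¬ 0 ≤ x} (1 : ℝ → ℝ≥0∞) y ∂(sumLaw ν m) := by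
          gcongr with y
          have hx0 := hx.1
          simp only [Set.indicator, Set.mem_ofPred_eq, Pi.one_apply]
          split_ifs with h1 h2
          · exact le_rfl
          · exact zero_le
          · linarith
          · exact le_rfl
      _ = 0 := by rw [lintegral_indicator_one hmeas]; exact ih

/-- Hoeffding's lemma for sums. -/
theorem lintegral_exp_sumLaw_le {ν : Measure ℝ} [IsProbabilityMeasure ν]
    (hν : ∀ᵐ x ∂ν, x ∈ Set.Icc (0 : ℝ) 1) (t : ℝ) (m : ℕ) :
    ∫⁻ x, ENNReal.ofReal (Real.exp (t * (x - m * ∫ y, y ∂ν))) ∂(sumLaw ν m) ≤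
      ENNReal.ofReal (Real.exp (t ^ 2 * m / 8)) := by
  set μ := ∫ y, y ∂ν with hμ
  have h1 : ∫⁻ x, ENNReal.ofReal (Real.exp (t * (x - μ))) ∂ν ≤
      ENNReal.ofReal (Real.exp (t ^ 2 / 8)) := by
    have h := hasSubgaussianMGF_of_mem_Icc (μ := ν) (X := fun x => x) (by fun_prop) hν
    rw [← ofReal_integral_eq_lintegral_ofReal (h.integrable_exp_mul t)
      (ae_of_all _ fun x => (Real.exp_pos _).le)]
    apply ENNReal.ofReal_le_ofReal
    have h2 := h.mgf_le t
    simp only [mgf] at h2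
    refine h2.trans (Real.exp_le_exp.2 (le_of_eq ?_))
    simp
    ring
  induction m with
  | zero => simp [sumLaw]
  | succ m ih =>
    rw [lintegral_sumLaw_succ ν m (by fun_prop)]
    have h3 : ∀ x y : ℝ, ENNReal.ofReal (Real.exp (t * (x + y - ((m + 1 : ℕ) : ℝ) * μ))) =
        ENNReal.ofReal (Real.exp (t * (x - μ))) *
          ENNReal.ofReal (Real.exp (t * (y - m * μ))) := by
      intro x y
      rw [← ENNReal.ofReal_mul (Real.exp_pos _).le, ← Real.exp_add]
      congr 2
      push_cast
      ring
    simp_rw [h3]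
    calc _ = ∫⁻ x, ENNReal.ofReal (Real.exp (t * (x - μ))) *
            ∫⁻ y, ENNReal.ofReal (Real.exp (t * (y - m * μ))) ∂(sumLaw ν m) ∂ν := by
          congr 1; ext x
          rw [lintegral_const_mul _ (by fun_prop)]
      _ = (∫⁻ x, ENNReal.ofReal (Real.exp (t * (x - μ))) ∂ν) *
            ∫⁻ y, ENNReal.ofReal (Real.exp (t * (y - m * μ))) ∂(sumLaw ν m) := by
          rw [lintegral_mul_const _ (by fun_prop)]
      _ ≤ ENNReal.ofReal (Real.exp (t ^ 2 / 8)) * ENNReal.ofReal (Real.exp (t ^ 2 * m / 8)) := by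
          gcongr
      _ = _ := by
          rw [← ENNReal.ofReal_mul (Real.exp_pos _).le, ← Real.exp_add]
          congr 2
          push_cast
          ring

/-- Hoeffding's inequality, with the two tails treated by the sign `e = 1` or `e = -1`. -/
theorem sumLaw_tail_le {ν : Measure ℝ} [IsProbabilityMeasure ν]
    (hν : ∀ᵐ x ∂ν, x ∈ Set.Icc (0 : ℝ) 1) {m : ℕ} (hm : 0 < m) {u e : ℝ} (hu : 0 ≤ u)
    (he : e ^ 2 = 1) :
    sumLaw ν m {x | u ≤ e * (x - m * ∫ y, y ∂ν)} ≤
      ENNReal.ofReal (Real.exp (-(2 * u ^ 2 / m))) := by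
  set μ := ∫ y, y ∂ν with hμ
  have hm' : (0 : ℝ) < m := by exact_mod_cast hm
  have hset : MeasurableSet {x : ℝ | u ≤ e * (x - m * μ)} :=
    measurableSet_le measurable_const (by fun_prop)
  rw [← lintegral_indicator_one hset]
  calc ∫⁻ x, Set.indicator {x : ℝ | u ≤ e * (x - m * μ)} 1 x ∂(sumLaw ν m)
      ≤ ∫⁻ x, ENNReal.ofReal (Real.exp (-(4 * u ^ 2 / m))) *
          ENNReal.ofReal (Real.exp (4 * u / m * e * (x - m * μ))) ∂(sumLaw ν m) := by
        gcongr with x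
        by_cases hx : x ∈ {x : ℝ | u ≤ e * (x - m * μ)}
        swap
        · rw [Set.indicator_of_notMem hx]
          exact zero_le
        rw [Set.indicator_of_mem hx, ← ENNReal.ofReal_mul (Real.exp_pos _).le, ← Real.exp_add]
        simp only [Pi.one_apply, ENNReal.one_le_ofReal, Real.one_le_exp_iff]
        have hx' : u ≤ e * (x - m * μ) := hx
        have : 4 * u / m * u ≤ 4 * u / m * (e * (x - m * μ)) :=
          mul_le_mul_of_nonneg_left hx' (by positivity)
        have h2 : 4 * u ^ 2 / m = 4 * u / m * u := by ring
        rw [h2]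
        linarith
    _ ≤ ENNReal.ofReal (Real.exp (-(4 * u ^ 2 / m))) *
          ENNReal.ofReal (Real.exp ((4 * u / m * e) ^ 2 * m / 8)) := by
        rw [lintegral_const_mul _ (by fun_prop)]
        gcongr
        exact lintegral_exp_sumLaw_le hν _ m
    _ = _ := by
        rw [← ENNReal.ofReal_mul (Real.exp_pos _).le, ← Real.exp_add]
        congr 2
        rw [mul_pow, he]
        field_simp
        ring

theorem lintegral_exp_mul_gaussian (t : ℝ) :
    ∫⁻ g, ENNReal.ofReal (Real.exp (t * g)) ∂(gaussianReal 0 1) =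
      ENNReal.ofReal (Real.exp (t ^ 2 / 2)) := by
  rw [← ofReal_integral_eq_lintegral_ofReal (integrable_exp_mul_gaussianReal t)
      (ae_of_all _ fun x => (Real.exp_pos _).le)]
  have := congrFun (mgf_fun_id_gaussianReal (μ := 0) (v := 1)) t
  simp only [mgf] at this
  rw [this]
  simp

theorem lintegral_exp_sq_gaussian {c : ℝ} (hc : c < 1 / 2) :
    ∫⁻ g, ENNReal.ofReal (Real.exp (c * g ^ 2)) ∂(gaussianReal 0 1) =
      ENNReal.ofReal (1 / √(1 - 2 * c)) := by
  rw [gaussianReal_of_var_ne_zero 0 one_ne_zero,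
    lintegral_withDensity_eq_lintegral_mul _ (measurable_gaussianPDF 0 1) (by fun_prop)]
  have h : ∀ g : ℝ, (gaussianPDF 0 1 * fun g => ENNReal.ofReal (Real.exp (c * g ^ 2))) g =
      ENNReal.ofReal ((√(2 * Real.pi))⁻¹ * Real.exp (-(1 / 2 - c) * g ^ 2)) := by
    intro g
    rw [Pi.mul_apply, gaussianPDF, gaussianPDFReal, ← ENNReal.ofReal_mul (by positivity), mul_assoc,
      ← Real.exp_add]
    congr 2
    · simp
    · congr 1; simp; ring
  simp_rw [h]
  rw [← ofReal_integral_eq_lintegral_ofReal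
    ((integrable_exp_neg_mul_sq (by linarith)).const_mul _)
      (ae_of_all _ fun x => by positivity), integral_const_mul, integral_gaussian]
  congr 1
  rw [← Real.sqrt_inv, ← Real.sqrt_mul (by positivity), one_div (√(1 - 2 * c)), ← Real.sqrt_inv]
  congr 1
  have h2 : (1 / 2 - c) ≠ 0 := by linarith
  have h3 : (1 - 2 * c) ≠ 0 := by linarith
  field_simp

/-- The squared deviation of a sum of bounded variables has exponential moments: by
`exp (t² / 2) = 𝔼 exp (t g)` with a standard Gaussian `g`, the square is linearized, and
Hoeffding's lemma applies for every fixed `g`. -/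
theorem lintegral_exp_sq_sumLaw_le {ν : Measure ℝ} [IsProbabilityMeasure ν]
    (hν : ∀ᵐ x ∂ν, x ∈ Set.Icc (0 : ℝ) 1) {m : ℕ} (hm : 0 < m) {k : ℝ} (hk0 : 0 ≤ k)
    (hk : k < 2) :
    ∫⁻ x, ENNReal.ofReal (Real.exp (k * (x - m * ∫ y, y ∂ν) ^ 2 / m)) ∂(sumLaw ν m) ≤
      ENNReal.ofReal (1 / √(1 - k / 2)) := by
  set μ := ∫ y, y ∂ν with hμ
  have hm' : (0 : ℝ) < m := by exact_mod_cast hm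
  have hs : √(2 * k / m) ^ 2 = 2 * k / m := Real.sq_sqrt (by positivity)
  have h1 : ∀ x : ℝ, ENNReal.ofReal (Real.exp (k * (x - m * μ) ^ 2 / m)) =
      ∫⁻ g, ENNReal.ofReal (Real.exp (√(2 * k / m) * (x - m * μ) * g)) ∂(gaussianReal 0 1) := by
    intro x
    rw [lintegral_exp_mul_gaussian, mul_pow, hs]
    congr 2
    field_simp
  simp_rw [h1]
  rw [lintegral_lintegral_swap (by fun_prop)]
  calc _ ≤ ∫⁻ g, ENNReal.ofReal (Real.exp (k / 4 * g ^ 2)) ∂(gaussianReal 0 1) := by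
        gcongr with g
        have := lintegral_exp_sumLaw_le hν (√(2 * k / m) * g) m
        rw [mul_pow, hs, ← hμ] at this
        have e1 : 2 * k / m * g ^ 2 * m / 8 = k / 4 * g ^ 2 := by field_simp; ring
        rw [e1] at this
        refine le_trans (le_of_eq ?_) this
        congr 1; ext x; congr 2; ring
    _ = _ := by
        rw [lintegral_exp_sq_gaussian (by linarith)]
        congr 4; ring

/-! ### Upper tails of the symmetric binomial distribution -/

/-- The probability that a sum of `m` independent Bernoulli variables with mean `p` is at least
`y`, defined by conditioning on one of the variables. -/
noncomputable def binTail (p : ℝ) : ℕ → ℝ → ℝ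
  | 0, y => if y ≤ 0 then 1 else 0
  | m + 1, y => p * binTail p m (y - 1) + (1 - p) * binTail p m y

theorem binTail_nonneg {p : ℝ} (h0 : 0 ≤ p) (h1 : p ≤ 1) (m : ℕ) (y : ℝ) : 0 ≤ binTail p m y := by
  induction m generalizing y with
  | zero => unfold binTail; split_ifs <;> norm_num
  | succ m ih =>
    exact add_nonneg (mul_nonneg h0 (ih _)) (mul_nonneg (sub_nonneg.2 h1) (ih _))

/-- Change of measure: by the Cauchy-Schwarz inequality, the probability of an event under a biased
coin is controlled by its probability under a fair coin and by the second moment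
`(1 + (2 * p - 1) ^ 2) ^ m` of the likelihood ratio. -/
theorem sq_binTail_le (p : ℝ) (m : ℕ) (y : ℝ) :
    binTail p m y ^ 2 ≤ (1 + (2 * p - 1) ^ 2) ^ m * binTail (1 / 2) m y := by
  induction m generalizing y with
  | zero => unfold binTail; split_ifs <;> norm_num
  | succ m ih =>
    have h1 := ih (y - 1)
    have h2 := ih y
    simp only [binTail]
    set A := binTail p m (y - 1)
    set B := binTail p m y
    -- Cauchy-Schwarz, with the weights `2 * p` and `2 * (1 - p)` on two equally likely points
    have h3 : (p * A + (1 - p) * B) ^ 2 ≤ (1 + (2 * p - 1) ^ 2) * ((A ^ 2 + B ^ 2) / 2) := by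
      nlinarith [sq_nonneg (p * B - (1 - p) * A)]
    calc _ ≤ _ := h3
      _ ≤ (1 + (2 * p - 1) ^ 2) * (((1 + (2 * p - 1) ^ 2) ^ m * binTail (1 / 2) m (y - 1) +
            (1 + (2 * p - 1) ^ 2) ^ m * binTail (1 / 2) m y) / 2) := by gcongr
      _ = _ := by ring

/-- A one-sided Chebyshev bound; `w` is a free parameter. -/
theorem one_sub_binTail_le {p : ℝ} (h0 : 0 ≤ p) (h1 : p ≤ 1) (m : ℕ) {y w : ℝ} (hw : y < w) :
    1 - binTail p m y ≤ (m * (p * (1 - p)) + (m * p - w) ^ 2) / (w - y) ^ 2 := by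
  induction m generalizing y w with
  | zero =>
    have hpos : 0 < (w - y) ^ 2 := by have := sub_pos.2 hw; positivity
    rw [le_div_iff₀ hpos]
    unfold binTail
    split_ifs with hy
    · simp; positivity
    · push Not at hy
      simp only [Nat.cast_zero, zero_mul, zero_add, zero_sub, sub_zero, one_mul, neg_sq]
      exact pow_le_pow_left₀ (by linarith) (by linarith) 2
  | succ m ih =>
    have e1 := ih (y := y - 1) (w := w - 1) (by linarith)
    have e2 := ih hw
    have e3 : w - 1 - (y - 1) = w - y := by ring
    rw [e3] at e1
    simp only [binTail]
    calc 1 - (p * binTail p m (y - 1) + (1 - p) * binTail p m y)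
        = p * (1 - binTail p m (y - 1)) + (1 - p) * (1 - binTail p m y) := by ring
      _ ≤ p * ((m * (p * (1 - p)) + (m * p - (w - 1)) ^ 2) / (w - y) ^ 2) +
          (1 - p) * ((m * (p * (1 - p)) + (m * p - w) ^ 2) / (w - y) ^ 2) :=
          add_le_add (mul_le_mul_of_nonneg_left e1 h0)
            (mul_le_mul_of_nonneg_left e2 (sub_nonneg.2 h1))
      _ = _ := by push_cast; ring

/-- A lower bound for the upper tail of the symmetric binomial distribution, with the same constant
for all deviations `x`. The biased coin with `m * p = m / 2 + x + D` reaches `m / 2 + x` with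
probability at least `1 / 4`. -/
theorem le_binTail_half {m : ℕ} (hm : 3 ≤ m) {x : ℝ} (hx0 : 0 ≤ x) (hx : x ≤ m / 3) :
    1 / 16 * Real.exp (-(4 * (x + √(m / 12)) ^ 2 / m)) ≤ binTail (1 / 2) m (m / 2 + x) := by
  have hm' : (3 : ℝ) ≤ m := by exact_mod_cast hm
  have hm0 : (0 : ℝ) < m := by linarith
  set D := √((m : ℝ) / 12) with hD
  have hDpos : 0 < D := Real.sqrt_pos.2 (by positivity)
  have hDsq : D ^ 2 = m / 12 := Real.sq_sqrt (by positivity)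
  have hDle : D ≤ m / 6 := by
    rw [hD]
    apply Real.sqrt_le_iff.2
    constructor
    · positivity
    · nlinarith
  set p := 1 / 2 + (x + D) / m with hp
  have hmp : m * p = m / 2 + x + D := by rw [hp]; field_simp; ring
  have hp0 : 0 ≤ p := by positivity
  have hp1 : p ≤ 1 := by
    have : (x + D) / m ≤ 1 / 2 := by
      rw [div_le_iff₀ hm0]; linarith
    rw [hp]; linarith
  have hquarter : 1 / 4 ≤ binTail p m (m / 2 + x) := by
    -- `w` is `3 * D` above the mean, which is optimal: `m / 4 = 3 * D ^ 2` bounds the variance,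
    -- and the threshold is `D` below the mean
    have h := one_sub_binTail_le hp0 hp1 m (y := m / 2 + x) (w := m / 2 + x + 4 * D) (by linarith)
    have h2 : (m * (p * (1 - p)) + (m * p - (m / 2 + x + 4 * D)) ^ 2) /
        (m / 2 + x + 4 * D - (m / 2 + x)) ^ 2 ≤ 3 / 4 := by
      rw [div_le_iff₀ (by ring_nf; positivity), hmp]
      have : p * (1 - p) ≤ 1 / 4 := by nlinarith [sq_nonneg (2 * p - 1)]
      have : m * (p * (1 - p)) ≤ m * (1 / 4) := by gcongr
      nlinarith
    linarith
  have hcs := sq_binTail_le p m (m / 2 + x)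
  have hz : (1 + (2 * p - 1) ^ 2) ^ m ≤ Real.exp (4 * (x + D) ^ 2 / m) := by
    calc (1 + (2 * p - 1) ^ 2) ^ m ≤ Real.exp ((2 * p - 1) ^ 2) ^ m := by
          gcongr
          rw [add_comm]
          exact Real.add_one_le_exp _
      _ = Real.exp (4 * (x + D) ^ 2 / m) := by
          rw [← Real.exp_nat_mul]
          congr 1
          rw [hp]
          field_simp
          ring
  have hT := binTail_nonneg (p := 1 / 2) (by norm_num) (by norm_num) m (m / 2 + x)
  have h16 : 1 / 16 ≤ Real.exp (4 * (x + D) ^ 2 / m) * binTail (1 / 2) m (m / 2 + x) := by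
    calc (1 : ℝ) / 16 = (1 / 4) ^ 2 := by norm_num
      _ ≤ binTail p m (m / 2 + x) ^ 2 := by gcongr
      _ ≤ _ := hcs
      _ ≤ _ := by gcongr
  rw [Real.exp_neg, ← div_eq_mul_inv, div_le_iff₀ (Real.exp_pos _)]
  linarith

instance : IsProbabilityMeasure fairBernoulli := by
  unfold fairBernoulli; infer_instance

theorem lintegral_fairBernoulli (f : ℝ → ℝ≥0∞) (hf : Measurable f) :
    ∫⁻ x, f x ∂fairBernoulli = ENNReal.ofReal (1 / 2) * f 1 + ENNReal.ofReal (1 / 2) * f 0 := by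
  rw [fairBernoulli, bernoulliMeasure_def, lintegral_add_measure]
  have h1 : ((unitInterval.toNNReal ⟨1 / 2, by norm_num, by norm_num⟩ : NNReal) : ℝ≥0∞) =
      ENNReal.ofReal (1 / 2) := by
    rw [ENNReal.ofReal]; congr 1
    ext; simp
  have h2 : ((unitInterval.toNNReal (unitInterval.symm ⟨1 / 2, by norm_num, by norm_num⟩) : NNReal)
      : ℝ≥0∞) = ENNReal.ofReal (1 / 2) := by
    rw [ENNReal.ofReal]; congr 1
    ext; simp; norm_num
  rw [lintegral_smul_measure, lintegral_smul_measure, lintegral_dirac' _ hf, lintegral_dirac' _ hf,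
    ENNReal.smul_def, ENNReal.smul_def, h1, h2, smul_eq_mul, smul_eq_mul]

theorem integral_fairBernoulli : ∫ x, x ∂fairBernoulli = 1 / 2 := by
  rw [fairBernoulli, integral_bernoulliMeasure]
  simp

theorem fairBernoulli_ae_mem : ∀ᵐ x ∂fairBernoulli, x ∈ Set.Icc (0 : ℝ) 1 := by
  rw [ae_iff, ← lintegral_indicator_one (by measurability),
    lintegral_fairBernoulli _ (measurable_one.indicator (by measurability))]
  simp

theorem sumLaw_fairBernoulli_Ici (m : ℕ) (y : ℝ) :
    sumLaw fairBernoulli m (Set.Ici y) = ENNReal.ofReal (binTail (1 / 2) m y) := by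
  induction m generalizing y with
  | zero =>
    rw [sumLaw, Measure.dirac_apply' _ measurableSet_Ici, binTail]
    by_cases h : y ≤ 0 <;> simp [h]
  | succ m ih =>
    have hn := binTail_nonneg (p := 1 / 2) (by norm_num) (by norm_num) m
    have h : ∀ x, ∫⁻ z, (Set.Ici y).indicator (1 : ℝ → ℝ≥0∞) (x + z) ∂(sumLaw fairBernoulli m) =
        ENNReal.ofReal (binTail (1 / 2) m (y - x)) := by
      intro x
      rw [← ih, ← lintegral_indicator_one measurableSet_Ici]
      congr 1; ext z
      simp only [Set.indicator, Set.mem_Ici, sub_le_iff_le_add']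
      rfl
    rw [← lintegral_indicator_one measurableSet_Ici, lintegral_sumLaw_succ _ _
      (measurable_one.indicator measurableSet_Ici), lintegral_fairBernoulli, h, h, binTail,
      ← ENNReal.ofReal_mul (by norm_num), ← ENNReal.ofReal_mul (by norm_num),
      ← ENNReal.ofReal_add (mul_nonneg (by norm_num) (hn _)) (mul_nonneg (by norm_num) (hn _))]
    · congr 2
      · rw [sub_zero]; norm_num
    · apply Measurable.lintegral_prod_right'
        (f := fun p : ℝ × ℝ => (Set.Ici y).indicator (1 : ℝ → ℝ≥0∞) (p.1 + p.2))
      exact (measurable_one.indicator measurableSet_Ici).comp (by fun_prop)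

/-! ### The expected inverse tail probability -/

/-- The comparison of constants behind `lintegral_inv_tail_le`. -/
theorem const_le_boundConst {a : ℝ} (ha : 2 < a) :
    16 * Real.exp ((1 + 4 / (a - 2)) / 3) * (1 / √(1 - (1 + 2 / a) / 2)) ≤ boundConst a := by
  obtain ⟨b, rfl⟩ : ∃ b, a = b + 2 := ⟨a - 2, by ring⟩
  have hb : 0 < b := by linarith
  have hba : 0 < b + 2 := by linarith
  simp only [add_sub_cancel_right, boundConst]
  have e1 : 1 / √(1 - (1 + 2 / (b + 2)) / 2) = √(2 * (b + 2)) / √b := by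
    have : 1 - (1 + 2 / (b + 2)) / 2 = b / (2 * (b + 2)) := by field_simp; ring
    rw [this, Real.sqrt_div hb.le, one_div_div]
  have hb2 : 0 < √b := Real.sqrt_pos.2 hb
  have hpi : 0 < √Real.pi := Real.sqrt_pos.2 Real.pi_pos
  have hpi2 : √Real.pi ≤ 1.8 := by
    apply Real.sqrt_le_iff.2
    constructor
    · norm_num
    · have := Real.pi_lt_d2
      norm_num at this ⊢; linarith
  -- `exp y ≥ e * y` at `y = 28 / b`
  have hexp : √28 * Real.exp (1 / 2) ≤ √b * Real.exp (14 / b) := by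
    apply le_of_sq_le_sq _ (by positivity)
    rw [mul_pow, mul_pow, Real.sq_sqrt hb.le, Real.sq_sqrt (by norm_num), ← Real.exp_nat_mul,
      ← Real.exp_nat_mul]
    have h := Real.add_one_le_exp (28 / b - 1)
    have h2 : Real.exp (28 / b) = Real.exp 1 * Real.exp (28 / b - 1) := by
      rw [← Real.exp_add]; congr 1; ring
    have h3 : ((2 : ℕ) : ℝ) * (14 / b) = 28 / b := by push_cast; ring
    have h4 : ((2 : ℕ) : ℝ) * (1 / 2) = 1 := by norm_num
    rw [h3, h4, h2]
    have h5 : 28 / b ≤ Real.exp (28 / b - 1) := by linarith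
    calc 28 * Real.exp 1 = b * (Real.exp 1 * (28 / b)) := by field_simp
      _ ≤ _ := by gcongr
  have h28 : (5 : ℝ) ≤ √28 := Real.le_sqrt_of_sq_le (by norm_num)
  have hone : 0 ≤ √(Real.pi * (b + 2) / (8 * b)) := Real.sqrt_nonneg _
  have key : 16 * Real.exp ((1 + 4 / b) / 3) * √Real.pi ≤
      Real.exp 2 * Real.exp (16 / b) * √b := by
    have e4 : Real.exp ((1 + 4 / b) / 3) ≤ Real.exp (1 / 2) * Real.exp (2 / b) := by
      rw [← Real.exp_add]
      apply Real.exp_le_exp.2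
      have : 0 < 1 / b := by positivity
      have h6 : 4 / b = 4 * (1 / b) := by ring
      have h7 : 2 / b = 2 * (1 / b) := by ring
      rw [h6, h7]; linarith
    have e5 : Real.exp (16 / b) = Real.exp (14 / b) * Real.exp (2 / b) := by
      rw [← Real.exp_add]; congr 1; ring
    have e6 : (7.29 : ℝ) ≤ Real.exp 2 := by
      have : Real.exp 2 = Real.exp 1 * Real.exp 1 := by rw [← Real.exp_add]; norm_num
      have h8 := Real.exp_one_gt_d9
      rw [this]; nlinarith
    calc _ ≤ 16 * (Real.exp (1 / 2) * Real.exp (2 / b)) * 1.8 := by gcongr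
      _ = 28.8 * (Real.exp (1 / 2) * Real.exp (2 / b)) := by ring
      _ ≤ (7.29 * 5) * (Real.exp (1 / 2) * Real.exp (2 / b)) := by gcongr; norm_num
      _ ≤ (Real.exp 2 * √28) * (Real.exp (1 / 2) * Real.exp (2 / b)) := by gcongr
      _ = Real.exp 2 * (√28 * Real.exp (1 / 2)) * Real.exp (2 / b) := by ring
      _ ≤ Real.exp 2 * (√b * Real.exp (14 / b)) * Real.exp (2 / b) := by gcongr
      _ = _ := by rw [e5]; ring
  rw [e1]
  calc 16 * Real.exp ((1 + 4 / b) / 3) * (√(2 * (b + 2)) / √b)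
      = (16 * Real.exp ((1 + 4 / b) / 3) * √Real.pi) * (√(2 * (b + 2)) / (√b * √Real.pi)) := by
        field_simp
    _ ≤ (Real.exp 2 * Real.exp (16 / b) * √b) * (√(2 * (b + 2)) / (√b * √Real.pi)) := by gcongr
    _ = Real.exp 2 * √(2 * (b + 2)) / √Real.pi * Real.exp (16 / b) * 1 := by field_simp
    _ ≤ _ := by gcongr; linarith

/-- The binomial tail bound in the form in which it is integrated: `x` is the deficit of the
sum of `s` rewards with respect to its mean. -/
theorem exp_neg_le_binTail {a s : ℕ} (ha : 2 < a) (hs : 0 < s) {x : ℝ} (hx : x ≤ s) :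
    (16 * Real.exp ((1 + 4 / ((a : ℝ) - 2)) / 3) * Real.exp ((1 + 2 / (a : ℝ)) * x ^ 2 / s))⁻¹ ≤
      binTail (1 / 2) (a * s) ((a * s : ℕ) / 2 + max x 0) := by
  have ha' : (3 : ℝ) ≤ a := by exact_mod_cast ha
  have hs' : (1 : ℝ) ≤ s := by exact_mod_cast hs
  have hs0 : (0 : ℝ) < s := by linarith
  have ha0 : (0 : ℝ) < a := by linarith
  have hb : (0 : ℝ) < a - 2 := by linarith
  have hm : 3 ≤ a * s := by nlinarith
  have hmax : max x 0 ≤ ((a * s : ℕ) : ℝ) / 3 := by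
    push_cast
    apply max_le
    · nlinarith
    · positivity
  refine le_trans ?_ (le_binTail_half hm (le_max_right x 0) hmax)
  push_cast
  set y := max x 0
  have hy : y ^ 2 ≤ x ^ 2 := by
    rcases le_total x 0 with h | h
    · simp only [y, max_eq_right h, ne_eq, OfNat.ofNat_ne_zero, not_false_eq_true, zero_pow,
        sq_nonneg]
    · simp [y, max_eq_left h]
  set D := √((a : ℝ) * s / 12) with hD
  have hDsq : D ^ 2 = a * s / 12 := Real.sq_sqrt (by positivity)
  -- the weight `(a + 2) / 4` leads to the factor `1 + 2 / a < 2` in the exponent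
  have hyoung : (y + D) ^ 2 ≤ (a + 2) / 4 * y ^ 2 + (a + 2) / (a - 2) * D ^ 2 := by
    have e : (a + 2) / 4 * y ^ 2 + (a + 2) / (a - 2) * D ^ 2 - (y + D) ^ 2 =
        ((a - 2) * y - 4 * D) ^ 2 / (4 * (a - 2)) := by
      field_simp
      ring
    have : 0 ≤ ((a - 2) * y - 4 * D) ^ 2 / (4 * (a - 2)) := by positivity
    linarith
  rw [mul_inv, mul_inv, ← Real.exp_neg, ← Real.exp_neg, mul_assoc, ← Real.exp_add]
  have h16 : (16 : ℝ)⁻¹ = 1 / 16 := by norm_num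
  rw [h16]
  gcongr
  have h1 : 4 * (y + D) ^ 2 / (a * s) ≤
      4 * ((a + 2) / 4 * x ^ 2 + (a + 2) / (a - 2) * (a * s / 12)) / (a * s) := by
    rw [← hDsq]
    gcongr
    calc _ ≤ _ := hyoung
      _ ≤ _ := by gcongr
  have h2 : 4 * ((a + 2) / 4 * x ^ 2 + (a + 2) / (a - 2) * (a * s / 12)) / (a * s) =
      (1 + 4 / ((a : ℝ) - 2)) / 3 + (1 + 2 / (a : ℝ)) * x ^ 2 / s := by
    field_simp
    ring
  linarith

theorem binTail_antitone (p : ℝ) (h0 : 0 ≤ p) (h1 : p ≤ 1) (m : ℕ) : Antitone (binTail p m) := by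
  induction m with
  | zero =>
    intro x y hxy
    simp only [binTail]
    split_ifs with h2 h3 h3
    · exact le_rfl
    · exact absurd (hxy.trans h2) h3
    · exact zero_le_one
    · exact le_rfl
  | succ m ih =>
    intro x y hxy
    simp only [binTail]
    have e1 := ih (sub_le_sub_right hxy 1)
    have e2 := ih hxy
    exact add_le_add (mul_le_mul_of_nonneg_left e1 h0)
      (mul_le_mul_of_nonneg_left e2 (sub_nonneg.2 h1))

/-- The expected inverse probability that the perturbations lift the sum of `s` rewards and `a * s`
pseudo-rewards above `θ * s`, where `θ` is at most the mean of this sum per pull, is bounded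
uniformly in `s`. -/
theorem lintegral_inv_tail_le {ν : Measure ℝ} [IsProbabilityMeasure ν]
    (hν : ∀ᵐ x ∂ν, x ∈ Set.Icc (0 : ℝ) 1) {a s : ℕ} (ha : 2 < a) (hs : 0 < s) {θ : ℝ}
    (hθ : θ ≤ ∫ x, x ∂ν + a / 2) :
    ∫⁻ v, (sumLaw fairBernoulli (a * s) (Set.Ici (θ * s - v)))⁻¹ ∂(sumLaw ν s) ≤
      ENNReal.ofReal (boundConst a) := by
  set μ := ∫ x, x ∂ν with hμ
  have ha' : (3 : ℝ) ≤ a := by exact_mod_cast ha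
  have hs' : (1 : ℝ) ≤ s := by exact_mod_cast hs
  have hμ1 : μ ≤ 1 := by
    have hint : Integrable (fun x : ℝ => x) ν := Integrable.of_mem_Icc 0 1 (by fun_prop) hν
    calc μ ≤ ∫ _, (1 : ℝ) ∂ν := integral_mono_ae hint (integrable_const _) (by
            filter_upwards [hν] with x hx using hx.2)
      _ = 1 := by simp
  set C := 16 * Real.exp ((1 + 4 / ((a : ℝ) - 2)) / 3) with hC
  have hCpos : 0 < C := by positivity
  calc ∫⁻ v, (sumLaw fairBernoulli (a * s) (Set.Ici (θ * s - v)))⁻¹ ∂(sumLaw ν s)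
      ≤ ∫⁻ v, ENNReal.ofReal C * ENNReal.ofReal (Real.exp ((1 + 2 / (a : ℝ)) *
          (v - s * μ) ^ 2 / s)) ∂(sumLaw ν s) := by
        apply lintegral_mono_ae
        filter_upwards [ae_nonneg_sumLaw hν s] with v hv
        have hx : s * μ - v ≤ s := by nlinarith
        have h := exp_neg_le_binTail ha hs hx
        rw [sumLaw_fairBernoulli_Ici, ← ENNReal.ofReal_mul hCpos.le, ENNReal.inv_le_iff_inv_le,
          ← ENNReal.ofReal_inv_of_pos (by positivity)]
        apply ENNReal.ofReal_le_ofReal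
        have e : (s * μ - v) ^ 2 = (v - s * μ) ^ 2 := by ring
        rw [e] at h
        refine h.trans (binTail_antitone _ (by norm_num) (by norm_num) _ ?_)
        have h2 := le_max_left (s * μ - v) 0
        push_cast
        nlinarith
    _ = ENNReal.ofReal C * ∫⁻ v, ENNReal.ofReal (Real.exp ((1 + 2 / (a : ℝ)) *
          (v - s * μ) ^ 2 / s)) ∂(sumLaw ν s) := lintegral_const_mul _ (by fun_prop)
    _ ≤ ENNReal.ofReal C * ENNReal.ofReal (1 / √(1 - (1 + 2 / (a : ℝ)) / 2)) := by
        gcongr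
        refine lintegral_exp_sq_sumLaw_le hν hs (by positivity) ?_
        have : 2 / (a : ℝ) < 1 := by rw [div_lt_one (by linarith)]; linarith
        linarith
    _ ≤ _ := by
        rw [← ENNReal.ofReal_mul hCpos.le]
        exact ENNReal.ofReal_le_ofReal (const_le_boundConst (by linarith))

/-! ### Independence, measurability and dynamics of a run -/

theorem indepFun_prodMk_left {Ω α β γ : Type*} [MeasurableSpace Ω] [MeasurableSpace α]
    [MeasurableSpace β] [MeasurableSpace γ] {P : Measure Ω} [IsProbabilityMeasure P]
    {A : Ω → α} {B : Ω → β} {C : Ω → γ} (hA : Measurable A) (hB : Measurable B)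
    (hC : Measurable C) (h1 : IndepFun A (fun ω => (B ω, C ω)) P) (h2 : IndepFun B C P) :
    IndepFun (fun ω => (A ω, B ω)) C P := by
  rw [indepFun_iff_map_prod_eq_prod_map_map (by fun_prop) (by fun_prop)] at h1 h2 ⊢
  have hAB : IndepFun A B P := by
    rw [← indepFun_iff_map_prod_eq_prod_map_map (by fun_prop) (by fun_prop)] at h1
    exact h1.comp measurable_id measurable_fst
  rw [(indepFun_iff_map_prod_eq_prod_map_map (by fun_prop) (by fun_prop)).1 hAB]
  have e : (fun ω => ((A ω, B ω), C ω)) =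
      MeasurableEquiv.prodAssoc.symm ∘ fun ω => (A ω, (B ω, C ω)) := rfl
  rw [e, ← Measure.map_map (by fun_prop) (by fun_prop), h1, h2]
  exact (MeasurePreserving.symm _ (measurePreserving_prodAssoc _ _ _)).map_eq

/-- Members of an independent family outside `T` are independent of what the members in `T`
determine. -/
theorem indepFun_of_disjoint {Ω ι α β : Type*} {δ : ι → Type*} [MeasurableSpace Ω]
    [MeasurableSpace α] [MeasurableSpace β] [∀ i, MeasurableSpace (δ i)] {P : Measure Ω}
    {f : ∀ i, Ω → δ i} (hf : ∀ i, Measurable (f i)) (hind : iIndepFun f P) {S T : Set ι}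
    (hST : Disjoint S T) {A : Ω → α} {B : Ω → β}
    (hA : Measurable[⨆ i ∈ S, MeasurableSpace.comap (f i) inferInstance] A)
    (hB : Measurable[⨆ i ∈ T, MeasurableSpace.comap (f i) inferInstance] B) :
    IndepFun A B P := by
  have h := indep_iSup_of_disjoint (fun i => (hf i).comap_le) hind hST
  exact indep_of_indep_of_le_left (indep_of_indep_of_le_right h hB.comap_le) hA.comap_le

/-- Integration of a function of two independent variables, with the second one replaced by an
independent copy. -/
theorem lintegral_indepFun {Ω α β : Type*} [MeasurableSpace Ω] [MeasurableSpace α]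
    [MeasurableSpace β] {P : Measure Ω} [IsProbabilityMeasure P] {A : Ω → α} {B : Ω → β}
    (hA : Measurable A) (hB : Measurable B) (h : IndepFun A B P) {F : α × β → ℝ≥0∞}
    (hF : Measurable F) :
    ∫⁻ ω, F (A ω, B ω) ∂P = ∫⁻ ω, ∫⁻ ω', F (A ω, B ω') ∂P ∂P := by
  have h1 : ∫⁻ ω, F (A ω, B ω) ∂P = ∫⁻ p, F p ∂(P.map fun ω => (A ω, B ω)) :=
    (lintegral_map hF (hA.prodMk hB)).symm
  rw [h1, (indepFun_iff_map_prod_eq_prod_map_map hA.aemeasurable hB.aemeasurable).1 h,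
    lintegral_prod _ hF.aemeasurable, lintegral_map hF.lintegral_prod_right' hA]
  congr 1; ext ω
  rw [lintegral_map (by fun_prop) hB]

/-- All the randomness of a run: the seed, the rewards and the pseudo-rewards. -/
abbrev Env (K : ℕ) (S : Type*) : Type _ := S × (ℕ → Fin K → ℝ) × (ℕ → Fin K → ℕ → ℝ)

/-- Replaces the rewards of round `t`. -/
def setReward {K : ℕ} {S : Type*} (e : Env K S) (t : ℕ) (r : Fin K → ℝ) : Env K S :=
  (e.1, Function.update e.2.1 t r, e.2.2)

/-- Replaces the pseudo-rewards of arm `j` in round `t`. -/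
def setPseudo {K : ℕ} {S : Type*} (e : Env K S) (t : ℕ) (j : Fin K) (w : ℕ → ℝ) : Env K S :=
  (e.1, e.2.1, Function.update e.2.2 t (Function.update (e.2.2 t) j w))

section Measurability

variable {K : ℕ} {S : Type*} [MeasurableSpace S]

theorem measurable_setReward (t : ℕ) :
    Measurable fun p : Env K S × (Fin K → ℝ) => setReward p.1 t p.2 := by
  unfold setReward
  refine Measurable.prodMk (by fun_prop) (Measurable.prodMk ?_ (by fun_prop))
  refine measurable_pi_iff.2 fun u => ?_
  by_cases h : u = t
  · subst h; simpa using measurable_snd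
  · simp only [Function.update_of_ne h]; fun_prop

theorem measurable_setPseudo (t : ℕ) (j : Fin K) :
    Measurable fun p : Env K S × (ℕ → ℝ) => setPseudo p.1 t j p.2 := by
  unfold setPseudo
  refine Measurable.prodMk (by fun_prop) (Measurable.prodMk (by fun_prop) ?_)
  refine measurable_pi_iff.2 fun u => measurable_pi_iff.2 fun i => ?_
  by_cases h : u = t
  · subst h
    by_cases hi : i = j
    · subst hi; simpa using measurable_snd
    · simp only [Function.update_self, Function.update_of_ne hi]; fun_prop
  · simp only [Function.update_of_ne h]; fun_prop

theorem measurable_pulls {t : ℕ} (i : Fin K) : Measurable fun h : History K t => pulls h i := by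
  unfold pulls
  refine Finset.measurable_sum _ fun l _ => Measurable.ite ?_ (by fun_prop) (by fun_prop)
  exact (measurableSet_singleton i).preimage (by fun_prop)

theorem measurable_cumReward {t : ℕ} (i : Fin K) :
    Measurable fun h : History K t => cumReward h i := by
  unfold cumReward
  refine Finset.measurable_sum _ fun l _ => Measurable.ite ?_ (by fun_prop) (by fun_prop)
  exact (measurableSet_singleton i).preimage (by fun_prop)

theorem measurable_estimate {t : ℕ} (a : ℕ) :
    Measurable fun p : History K t × (Fin K → ℕ → ℝ) => estimate a p.1 p.2 := by
  refine measurable_pi_iff.2 fun i => ?_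
  have hp : Measurable fun p : History K t × (Fin K → ℕ → ℝ) => pulls p.1 i :=
    (measurable_pulls i).comp measurable_fst
  have hc : Measurable fun p : History K t × (Fin K → ℕ → ℝ) => cumReward p.1 i :=
    (measurable_cumReward i).comp measurable_fst
  have hs : Measurable fun p : History K t × (Fin K → ℕ → ℝ) =>
      ∑ l ∈ Finset.range (a * pulls p.1 i), p.2 i l := by
    have h1 : Measurable fun q : (Fin K → ℕ → ℝ) × ℕ => ∑ l ∈ Finset.range (a * q.2), q.1 i l :=
      measurable_from_prod_countable_left fun m => by
        refine Finset.measurable_sum (Finset.range (a * m))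
          (f := fun l (q : Fin K → ℕ → ℝ) => q i l) fun l _ => ?_
        fun_prop
    exact h1.comp (measurable_snd.prodMk hp)
  unfold estimate
  refine Measurable.ite ?_ ?_ (by fun_prop)
  · exact measurableSet_lt measurable_const hp
  · refine measurable_coe_real_ereal.comp ?_
    have hp' : Measurable fun p : History K t × (Fin K → ℕ → ℝ) => (pulls p.1 i : ℝ) :=
      measurable_from_nat.comp hp
    exact (hc.add hs).div (measurable_const.mul hp')

theorem measurable_history (a : ℕ) (rule : ArgmaxRule K S) (t : ℕ) :
    Measurable fun e : Env K S => history a rule e.1 e.2.1 e.2.2 t := by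
  induction t with
  | zero => exact measurable_pi_iff.2 fun l => l.elim0
  | succ t ih =>
    have harm : Measurable fun e : Env K S =>
        nextArm a rule e.1 (history a rule e.1 e.2.1 e.2.2 t) (e.2.2 t) := by
      unfold nextArm
      refine (rule.measurable_select t).comp (ih.prodMk (Measurable.prodMk ?_ measurable_fst))
      exact (measurable_estimate a).comp (ih.prodMk (by fun_prop))
    have hy : Measurable fun e : Env K S =>
        e.2.1 t (nextArm a rule e.1 (history a rule e.1 e.2.1 e.2.2 t) (e.2.2 t)) := by
      have h1 : Measurable fun q : (Fin K → ℝ) × Fin K => q.1 q.2 :=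
        measurable_from_prod_countable_left fun m => by fun_prop
      exact h1.comp (Measurable.prodMk (by fun_prop) harm)
    refine measurable_pi_iff.2 fun l => ?_
    refine Fin.lastCases ?_ (fun l => ?_) l
    · simp only [history, Fin.snoc_last]
      exact harm.prodMk hy
    · simp only [history, Fin.snoc_castSucc]
      exact (measurable_pi_apply l).comp ih

theorem measurable_arm (a : ℕ) (rule : ArgmaxRule K S) (t : ℕ) :
    Measurable fun e : Env K S => arm a rule e.1 e.2.1 e.2.2 t := by
  unfold arm nextArm
  have ih := measurable_history a rule t
  refine (rule.measurable_select t).comp (ih.prodMk (Measurable.prodMk ?_ measurable_fst))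
  exact (measurable_estimate a).comp (ih.prodMk (by fun_prop))

end Measurability

section Dynamics

variable {K : ℕ} {S : Type*} [MeasurableSpace S]

theorem history_congr (a : ℕ) (rule : ArgmaxRule K S) (s : S) {y y' : ℕ → Fin K → ℝ}
    {z z' : ℕ → Fin K → ℕ → ℝ} {t : ℕ} (hy : ∀ u < t, y u = y' u) (hz : ∀ u < t, z u = z' u) :
    history a rule s y z t = history a rule s y' z' t := by
  induction t with
  | zero => rfl
  | succ t ih =>
    simp only [history, ih (fun u hu => hy u (by omega)) (fun u hu => hz u (by omega)),
      hy t (by omega), hz t (by omega)]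

theorem history_setReward (a : ℕ) (rule : ArgmaxRule K S) (e : Env K S) (t : ℕ) (r : Fin K → ℝ) :
    history a rule (setReward e t r).1 (setReward e t r).2.1 (setReward e t r).2.2 t =
      history a rule e.1 e.2.1 e.2.2 t :=
  history_congr a rule _ (fun u hu => by simp [setReward, Function.update_of_ne hu.ne])
    (fun _ _ => rfl)

theorem arm_setReward (a : ℕ) (rule : ArgmaxRule K S) (e : Env K S) (t : ℕ) (r : Fin K → ℝ) :
    arm a rule (setReward e t r).1 (setReward e t r).2.1 (setReward e t r).2.2 t =
      arm a rule e.1 e.2.1 e.2.2 t := by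
  simp only [arm, history_setReward]
  rfl

theorem history_setPseudo (a : ℕ) (rule : ArgmaxRule K S) (e : Env K S) (t : ℕ) (j : Fin K)
    (w : ℕ → ℝ) :
    history a rule (setPseudo e t j w).1 (setPseudo e t j w).2.1 (setPseudo e t j w).2.2 t =
      history a rule e.1 e.2.1 e.2.2 t :=
  history_congr a rule _ (fun _ _ => rfl)
    (fun u hu => by simp [setPseudo, Function.update_of_ne hu.ne])

theorem history_succ (a : ℕ) (rule : ArgmaxRule K S) (s : S) (y : ℕ → Fin K → ℝ)
    (z : ℕ → Fin K → ℕ → ℝ) (t : ℕ) :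
    history a rule s y z (t + 1) = Fin.snoc (α := fun _ => Fin K × ℝ) (history a rule s y z t)
      (arm a rule s y z t, y t (arm a rule s y z t)) := rfl

theorem pulls_succ (a : ℕ) (rule : ArgmaxRule K S) (s : S) (y : ℕ → Fin K → ℝ)
    (z : ℕ → Fin K → ℕ → ℝ) (t : ℕ) (j : Fin K) :
    pulls (history a rule s y z (t + 1)) j =
      pulls (history a rule s y z t) j + if arm a rule s y z t = j then 1 else 0 := by
  simp [pulls, history_succ, Fin.sum_univ_castSucc]

theorem cumReward_succ (a : ℕ) (rule : ArgmaxRule K S) (s : S) (y : ℕ → Fin K → ℝ)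
    (z : ℕ → Fin K → ℕ → ℝ) (t : ℕ) (j : Fin K) :
    cumReward (history a rule s y z (t + 1)) j =
      cumReward (history a rule s y z t) j + if arm a rule s y z t = j then y t j else 0 := by
  simp only [cumReward, history_succ, Fin.sum_univ_castSucc, Fin.snoc_castSucc, Fin.snoc_last]
  congr 1
  split_ifs with h
  · rw [h]
  · rfl

theorem pulls_le {t : ℕ} (h : History K t) (j : Fin K) : pulls h j ≤ t := by
  unfold pulls
  calc _ ≤ ∑ _l : Fin t, 1 := Finset.sum_le_sum fun l _ => by split_ifs <;> simp
    _ = t := by simp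

theorem cumReward_eq_zero {t : ℕ} {h : History K t} {j : Fin K} (h0 : pulls h j = 0) :
    cumReward h j = 0 := by
  unfold pulls at h0
  unfold cumReward
  rw [Finset.sum_eq_zero_iff] at h0
  refine Finset.sum_eq_zero fun l hl => ?_
  have := h0 l hl
  split_ifs at this ⊢ with h1
  rfl

/-- Comparison of an estimate with a threshold, cleared of the denominator. For an arm that has not
been pulled, both sides are true. -/
theorem le_estimate_iff {a t : ℕ} (h : History K t) (z : Fin K → ℕ → ℝ) (i : Fin K) (θ : ℝ) :
    ((θ / (a + 1) : ℝ) : EReal) ≤ estimate a h z i ↔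
      θ * pulls h i - cumReward h i ≤ ∑ l ∈ Finset.range (a * pulls h i), z i l := by
  unfold estimate
  split_ifs with hp
  · have h1 : (0 : ℝ) < pulls h i := by exact_mod_cast hp
    have h2 : (0 : ℝ) < a + 1 := by positivity
    rw [EReal.coe_le_coe_iff, div_le_div_iff₀ h2 (by positivity), sub_le_iff_le_add']
    have e : θ * ((a + 1) * (pulls h i : ℝ)) = (θ * pulls h i) * (a + 1) := by ring
    rw [e]
    exact mul_le_mul_iff_of_pos_right h2
  · have h0 : pulls h i = 0 := by omega
    simp [h0, cumReward_eq_zero h0]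

end Dynamics

/-! ### Resampling one round -/

/-- The probabilistic model: `Y` are the rewards, `Z` the pseudo-rewards, `ξ` is the seed. -/
structure IsModel {K : ℕ} {Ω S : Type*} [MeasurableSpace Ω] [MeasurableSpace S]
    (P : Measure Ω) (ν : Fin K → Measure ℝ) (Y : ℕ → Fin K → Ω → ℝ)
    (Z : ℕ → Fin K → ℕ → Ω → ℝ) (ξ : Ω → S) : Prop where
  measurable_reward : ∀ t i, Measurable (Y t i)
  law_reward : ∀ t i, P.map (Y t i) = ν i
  indep_reward : iIndepFun (fun (t : ℕ) (ω : Ω) (i : Fin K) => Y t i ω) P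
  measurable_pseudo : ∀ t i l, Measurable (Z t i l)
  law_pseudo : ∀ t i l, P.map (Z t i l) = fairBernoulli
  indep_pseudo : iIndepFun (fun (p : ℕ × Fin K × ℕ) (ω : Ω) => Z p.1 p.2.1 p.2.2 ω) P
  indep_reward_pseudo : IndepFun (fun ω t i => Y t i ω) (fun ω t i l => Z t i l ω) P
  measurable_seed : Measurable ξ
  indep_seed : IndepFun ξ (fun ω => ((fun t i => Y t i ω : ℕ → Fin K → ℝ),
    (fun t i l => Z t i l ω : ℕ → Fin K → ℕ → ℝ))) P

/-- The realized randomness. -/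
def env {K : ℕ} {Ω S : Type*} (Y : ℕ → Fin K → Ω → ℝ) (Z : ℕ → Fin K → ℕ → Ω → ℝ) (ξ : Ω → S)
    (ω : Ω) : Env K S :=
  (ξ ω, fun t i => Y t i ω, fun t i l => Z t i l ω)

/-- The history of the first `t` rounds. -/
noncomputable def hist {K : ℕ} {S : Type*} [MeasurableSpace S] (a : ℕ) (rule : ArgmaxRule K S) (t : ℕ)
    (e : Env K S) : History K t :=
  history a rule e.1 e.2.1 e.2.2 t

/-- The arm pulled in round `t`. -/
noncomputable def pulledArm {K : ℕ} {S : Type*} [MeasurableSpace S] (a : ℕ) (rule : ArgmaxRule K S) (t : ℕ)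
    (e : Env K S) : Fin K :=
  arm a rule e.1 e.2.1 e.2.2 t

namespace IsModel

variable {K : ℕ} {Ω S : Type*} [MeasurableSpace Ω] [MeasurableSpace S]
  {P : Measure Ω} {ν : Fin K → Measure ℝ} {Y : ℕ → Fin K → Ω → ℝ}
  {Z : ℕ → Fin K → ℕ → Ω → ℝ} {ξ : Ω → S}

theorem measurable_env (M : IsModel P ν Y Z ξ) : Measurable (env Y Z ξ) := by
  refine M.measurable_seed.prodMk (Measurable.prodMk ?_ ?_)
  · exact measurable_pi_iff.2 fun t => measurable_pi_iff.2 fun i => M.measurable_reward t i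
  · exact measurable_pi_iff.2 fun t => measurable_pi_iff.2 fun i => measurable_pi_iff.2 fun l =>
      M.measurable_pseudo t i l

variable [IsProbabilityMeasure P]

/-- The rewards of a round may be replaced by an independent copy. -/
theorem lintegral_setReward (M : IsModel P ν Y Z ξ) (t : ℕ) {F : Env K S → ℝ≥0∞}
    (hF : Measurable F) :
    ∫⁻ ω, F (env Y Z ξ ω) ∂P =
      ∫⁻ ω, ∫⁻ ω', F (setReward (env Y Z ξ ω) t fun i => Y t i ω') ∂P ∂P := by
  have hYm : Measurable fun ω t i => Y t i ω := M.measurable_env.snd.fst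
  have hZm : Measurable fun ω t i l => Z t i l ω := M.measurable_env.snd.snd
  have hrow : ∀ u, Measurable fun ω i => Y u i ω := fun u =>
    measurable_pi_iff.2 fun i => M.measurable_reward u i
  have hupd : Measurable fun (y : ℕ → Fin K → ℝ) => Function.update y t 0 := by
    refine measurable_pi_iff.2 fun u => ?_
    by_cases h : u = t
    · subst h; simp
    · simp only [Function.update_of_ne h]; fun_prop
  have h1 : IndepFun (fun ω => Function.update (fun u i => Y u i ω) t 0)
      (fun ω i => Y t i ω) P := by
    refine indepFun_of_disjoint hrow M.indep_reward (S := {t}ᶜ) (T := {t})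
      disjoint_compl_left ?_ ?_
    · refine (@measurable_pi_iff _ _ _ (_) _ _).2 fun u => ?_
      by_cases h : u = t
      · subst h; simp
      · simp only [Function.update_of_ne h]
        exact (comap_measurable _).mono (le_iSup₂_of_le u h le_rfl) le_rfl
    · exact (comap_measurable _).mono (le_iSup₂_of_le t rfl le_rfl) le_rfl
  have h2 : IndepFun (fun ω => (ξ ω, fun t i l => Z t i l ω)) (fun ω t i => Y t i ω) P := by
    refine indepFun_prodMk_left M.measurable_seed hZm hYm ?_ M.indep_reward_pseudo.symm
    exact M.indep_seed.comp measurable_id measurable_swap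
  have h3 : IndepFun (fun ω => ((ξ ω, fun t i l => Z t i l ω),
      Function.update (fun u i => Y u i ω) t 0)) (fun ω i => Y t i ω) P := by
    refine indepFun_prodMk_left (M.measurable_seed.prodMk hZm) (hupd.comp hYm) (hrow t) ?_ h1
    exact h2.comp measurable_id (hupd.prodMk (measurable_pi_apply t))
  have h4 : IndepFun (fun ω => setReward (env Y Z ξ ω) t 0) (fun ω i => Y t i ω) P :=
    h3.comp (φ := fun q : (S × (ℕ → Fin K → ℕ → ℝ)) × (ℕ → Fin K → ℝ) => (q.1.1, q.2, q.1.2))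
      (by fun_prop) measurable_id
  have h5 := lintegral_indepFun (P := P)
    (((measurable_setReward t).comp (measurable_id.prodMk measurable_const)).comp M.measurable_env)
    (hrow t) h4 (hF.comp (measurable_setReward t))
  simp only [Function.comp_def, id_eq] at h5
  have e1 : ∀ (e : Env K S) (r r' : Fin K → ℝ),
      setReward (setReward e t r) t r' = setReward e t r' := fun e r r' => by simp [setReward]
  have e2 : ∀ ω, setReward (env Y Z ξ ω) t (fun i => Y t i ω) = env Y Z ξ ω := fun ω => by
    simp only [setReward, env]
    congr 2
    exact Function.update_eq_self t (fun u i => Y u i ω)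
  simp only [e1, e2] at h5
  exact h5

/-- The pseudo-rewards of an arm in a round may be replaced by an independent copy. -/
theorem lintegral_setPseudo (M : IsModel P ν Y Z ξ) (t : ℕ) (j : Fin K) {F : Env K S → ℝ≥0∞}
    (hF : Measurable F) :
    ∫⁻ ω, F (env Y Z ξ ω) ∂P =
      ∫⁻ ω, ∫⁻ ω', F (setPseudo (env Y Z ξ ω) t j fun l => Z t j l ω') ∂P ∂P := by
  have hYm : Measurable fun ω t i => Y t i ω := M.measurable_env.snd.fst
  have hZm : Measurable fun ω t i l => Z t i l ω := M.measurable_env.snd.snd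
  have hrow : Measurable fun ω l => Z t j l ω :=
    measurable_pi_iff.2 fun l => M.measurable_pseudo t j l
  have hupd : Measurable fun (z : ℕ → Fin K → ℕ → ℝ) =>
      Function.update z t (Function.update (z t) j 0) := by
    refine measurable_pi_iff.2 fun u => measurable_pi_iff.2 fun i => ?_
    by_cases h : u = t
    · subst h
      by_cases hi : i = j
      · subst hi; simp
      · simp only [Function.update_self, Function.update_of_ne hi]; fun_prop
    · simp only [Function.update_of_ne h]; fun_prop
  have h1 : IndepFun (fun ω => Function.update (fun u i l => Z u i l ω) t
      (Function.update (fun i l => Z t i l ω) j 0)) (fun ω l => Z t j l ω) P := by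
    refine indepFun_of_disjoint 
      (fun p : ℕ × Fin K × ℕ => M.measurable_pseudo p.1 p.2.1 p.2.2) M.indep_pseudo
      (S := {p : ℕ × Fin K × ℕ | p.1 = t ∧ p.2.1 = j}ᶜ) (T := {p : ℕ × Fin K × ℕ | p.1 = t ∧ p.2.1 = j})
      disjoint_compl_left ?_ ?_
    · refine (@measurable_pi_iff _ _ _ (_) _ _).2 fun u =>
        (@measurable_pi_iff _ _ _ (_) _ _).2 fun i =>
        (@measurable_pi_iff _ _ _ (_) _ _).2 fun l => ?_
      by_cases h : u = t ∧ i = j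
      · obtain ⟨rfl, rfl⟩ := h; simp
      · have e : (fun ω => Function.update (fun u i l => Z u i l ω) t
            (Function.update (fun i l => Z t i l ω) j 0) u i l) = fun ω => Z u i l ω := by
          ext ω
          by_cases hu : u = t
          · subst hu
            have hi : i ≠ j := fun hi => h ⟨rfl, hi⟩
            simp [Function.update_of_ne hi]
          · simp [Function.update_of_ne hu]
        rw [e]
        exact (comap_measurable _).mono (le_iSup₂_of_le (u, i, l) h le_rfl) le_rfl
    · refine (@measurable_pi_iff _ _ _ (_) _ _).2 fun l => ?_
      exact (comap_measurable _).mono (le_iSup₂_of_le (t, j, l) ⟨rfl, rfl⟩ le_rfl) le_rfl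
  have h2 : IndepFun (fun ω => (ξ ω, fun t i => Y t i ω)) (fun ω t i l => Z t i l ω) P :=
    indepFun_prodMk_left M.measurable_seed hYm hZm M.indep_seed M.indep_reward_pseudo
  have h3 : IndepFun (fun ω => ((ξ ω, fun t i => Y t i ω),
      Function.update (fun u i l => Z u i l ω) t (Function.update (fun i l => Z t i l ω) j 0)))
      (fun ω l => Z t j l ω) P := by
    refine indepFun_prodMk_left (M.measurable_seed.prodMk hYm) (hupd.comp hZm) hrow ?_ h1
    exact h2.comp measurable_id (hupd.prodMk (γ := ℕ → ℝ)
      (g := fun z : ℕ → Fin K → ℕ → ℝ => z t j) (by fun_prop))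
  have h4 : IndepFun (fun ω => setPseudo (env Y Z ξ ω) t j 0) (fun ω l => Z t j l ω) P :=
    h3.comp (φ := fun q : (S × (ℕ → Fin K → ℝ)) × (ℕ → Fin K → ℕ → ℝ) => (q.1.1, q.1.2, q.2))
      (by fun_prop) measurable_id
  have h5 := lintegral_indepFun (P := P)
    (((measurable_setPseudo t j).comp (measurable_id.prodMk measurable_const)).comp
      M.measurable_env) hrow h4 (hF.comp (measurable_setPseudo t j))
  simp only [Function.comp_def, id_eq] at h5
  have e1 : ∀ (e : Env K S) (r r' : ℕ → ℝ),
      setPseudo (setPseudo e t j r) t j r' = setPseudo e t j r' := fun e r r' => by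
    simp [setPseudo]
  have e2 : ∀ ω, setPseudo (env Y Z ξ ω) t j (fun l => Z t j l ω) = env Y Z ξ ω := fun ω => by
    simp only [setPseudo, env]
    congr 2
    have : Function.update (fun i l => Z t i l ω) j (fun l => Z t j l ω) = fun i l => Z t i l ω :=
      Function.update_eq_self j (fun i l => Z t i l ω)
    rw [this]
    exact Function.update_eq_self t (fun u i l => Z u i l ω)
  simp only [e1, e2] at h5
  exact h5

theorem measure_le_sum_pseudo (M : IsModel P ν Y Z ξ) (t : ℕ) (j : Fin K) (m : ℕ) (y : ℝ) :
    P {ω | y ≤ ∑ l ∈ Finset.range m, Z t j l ω} = sumLaw fairBernoulli m (Set.Ici y) := by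
  have hind : iIndepFun (fun l => Z t j l) P :=
    M.indep_pseudo.precomp (g := fun l : ℕ => (t, j, l)) (fun l l' h => by simpa using h)
  rw [← map_sum_eq_sumLaw (fun l => M.measurable_pseudo t j l) (M.law_pseudo t j) hind m,
    Measure.map_apply (Finset.measurable_sum _ fun l _ => M.measurable_pseudo t j l)
      measurableSet_Ici]
  rfl

end IsModel

section

variable {K : ℕ} {S : Type*} [MeasurableSpace S]

theorem measurable_pulls_hist (a : ℕ) (rule : ArgmaxRule K S) (t : ℕ) (j : Fin K) :
    Measurable fun e => pulls (hist a rule t e) j :=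
  (measurable_pulls j).comp (measurable_history a rule t)

theorem measurable_cumReward_hist (a : ℕ) (rule : ArgmaxRule K S) (t : ℕ) (j : Fin K) :
    Measurable fun e => cumReward (hist a rule t e) j :=
  (measurable_cumReward j).comp (measurable_history a rule t)

theorem measurable_pulledArm (a : ℕ) (rule : ArgmaxRule K S) (t : ℕ) :
    Measurable (pulledArm a rule t) :=
  measurable_arm a rule t

end

/-! ### Visits of an arm and the exploration argument -/

/-- The expectation of `f` at the sum of the first `s` rewards of an arm, given that its first `k`
rewards sum to `v`; it is `0` if the arm has been pulled more than `s` times. -/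
noncomputable def visitPotential (ν : Measure ℝ) (s : ℕ) (f : ℝ → ℝ≥0∞) (k : ℕ) (v : ℝ) : ℝ≥0∞ :=
  if k ≤ s then ∫⁻ x, f (v + x) ∂(sumLaw ν (s - k)) else 0

theorem measurable_visitPotential (ν : Measure ℝ) [IsProbabilityMeasure ν] (s : ℕ)
    {f : ℝ → ℝ≥0∞} (hf : Measurable f) (k : ℕ) : Measurable (visitPotential ν s f k) := by
  unfold visitPotential
  split_ifs
  · exact Measurable.lintegral_prod_right' (f := fun p : ℝ × ℝ => f (p.1 + p.2))
      (hf.comp (by fun_prop))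
  · exact measurable_const

theorem visitPotential_self (ν : Measure ℝ) (s : ℕ) {f : ℝ → ℝ≥0∞} (hf : Measurable f) (v : ℝ) :
    visitPotential ν s f s v = f v := by
  simp only [visitPotential, le_refl, if_true, Nat.sub_self, sumLaw]
  rw [lintegral_dirac' _ (by fun_prop), add_zero]

theorem lintegral_visitPotential_succ (ν : Measure ℝ) [IsProbabilityMeasure ν] {s k : ℕ}
    (hk : k < s) {f : ℝ → ℝ≥0∞} (hf : Measurable f) (v : ℝ) :
    ∫⁻ x, visitPotential ν s f (k + 1) (v + x) ∂ν = visitPotential ν s f k v := by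
  obtain ⟨d, rfl⟩ : ∃ d, s = k + 1 + d := ⟨s - (k + 1), by omega⟩
  have h1 : k + 1 + d - k = d + 1 := by omega
  have h2 : k + 1 + d - (k + 1) = d := by omega
  have h3 : k ≤ k + 1 + d := by omega
  simp only [visitPotential, h1, h2, h3, if_true, le_add_iff_nonneg_right, Nat.zero_le]
  rw [lintegral_sumLaw_succ ν d (by fun_prop)]
  simp only [add_assoc]

/-- The probability that the estimate of an arm is at least `θ / (a + 1)`, given its number of
pulls `s` and its cumulative reward `v`. -/
noncomputable def exceedProb (a : ℕ) (θ : ℝ) (s : ℕ) (v : ℝ) : ℝ≥0∞ :=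
  sumLaw fairBernoulli (a * s) (Set.Ici (θ * s - v))

theorem measurable_exceedProb (a : ℕ) (θ : ℝ) (s : ℕ) : Measurable (exceedProb a θ s) := by
  have h : Antitone fun y => sumLaw fairBernoulli (a * s) (Set.Ici y) :=
    fun x y hxy => measure_mono (Set.Ici_subset_Ici.2 hxy)
  exact h.measurable.comp (by fun_prop)

theorem exceedProb_le_one (a : ℕ) (θ : ℝ) (s : ℕ) (v : ℝ) : exceedProb a θ s v ≤ 1 :=
  prob_le_one

section

variable {K : ℕ} {S : Type*} [MeasurableSpace S]

theorem pulls_hist_succ (a : ℕ) (rule : ArgmaxRule K S) (t : ℕ) (e : Env K S) (j : Fin K) :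
    pulls (hist a rule (t + 1) e) j =
      pulls (hist a rule t e) j + if pulledArm a rule t e = j then 1 else 0 :=
  pulls_succ a rule _ _ _ t j

theorem cumReward_hist_succ (a : ℕ) (rule : ArgmaxRule K S) (t : ℕ) (e : Env K S) (j : Fin K) :
    cumReward (hist a rule (t + 1) e) j =
      cumReward (hist a rule t e) j + if pulledArm a rule t e = j then e.2.1 t j else 0 :=
  cumReward_succ a rule _ _ _ t j

theorem hist_setReward (a : ℕ) (rule : ArgmaxRule K S) (t : ℕ) (e : Env K S) (r : Fin K → ℝ) :
    hist a rule t (setReward e t r) = hist a rule t e :=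
  history_setReward a rule e t r

theorem pulledArm_setReward (a : ℕ) (rule : ArgmaxRule K S) (t : ℕ) (e : Env K S)
    (r : Fin K → ℝ) : pulledArm a rule t (setReward e t r) = pulledArm a rule t e :=
  arm_setReward a rule e t r

/-- The estimates of round `t`. -/
noncomputable def estimates (a : ℕ) (rule : ArgmaxRule K S) (t : ℕ) (e : Env K S) :
    Fin K → EReal :=
  estimate a (hist a rule t e) (e.2.2 t)

theorem estimates_le_pulledArm (a : ℕ) (rule : ArgmaxRule K S) (t : ℕ) (e : Env K S) (i : Fin K) :
    estimates a rule t e i ≤ estimates a rule t e (pulledArm a rule t e) :=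
  rule.isMax t _ _ _ i

theorem hist_setPseudo (a : ℕ) (rule : ArgmaxRule K S) (t : ℕ) (e : Env K S) (j : Fin K)
    (w : ℕ → ℝ) : hist a rule t (setPseudo e t j w) = hist a rule t e :=
  history_setPseudo a rule e t j w

theorem estimates_setPseudo_of_ne (a : ℕ) (rule : ArgmaxRule K S) (t : ℕ) (e : Env K S)
    {i j : Fin K} (hij : i ≠ j) (w : ℕ → ℝ) :
    estimates a rule t (setPseudo e t j w) i = estimates a rule t e i := by
  simp only [estimates, hist_setPseudo]
  simp only [estimate, setPseudo, Function.update_self, Function.update_of_ne hij]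

theorem measurable_estimates (a : ℕ) (rule : ArgmaxRule K S) (t : ℕ) (j : Fin K) :
    Measurable fun e : Env K S => estimates a rule t e j :=
  (measurable_pi_apply j).comp ((measurable_estimate a).comp
    ((measurable_history a rule t).prodMk (by fun_prop)))

theorem measurable_comp_hist (a : ℕ) (rule : ArgmaxRule K S) (t : ℕ) (j : Fin K)
    {g : ℕ → ℝ → ℝ≥0∞} (hg : ∀ s, Measurable (g s)) :
    Measurable fun e : Env K S =>
      g (pulls (hist a rule t e) j) (cumReward (hist a rule t e) j) := by
  have h1 : Measurable fun q : ℕ × ℝ => g q.1 q.2 := measurable_from_prod_countable_right hg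
  exact h1.comp ((measurable_pulls_hist a rule t j).prodMk (measurable_cumReward_hist a rule t j))

end

namespace IsModel

variable {K : ℕ} {Ω S : Type*} [MeasurableSpace Ω] [MeasurableSpace S]
  {P : Measure Ω} [IsProbabilityMeasure P] {ν : Fin K → Measure ℝ}
  {Y : ℕ → Fin K → Ω → ℝ}
  {Z : ℕ → Fin K → ℕ → Ω → ℝ} {ξ : Ω → S}

section Visits

variable [∀ i, IsProbabilityMeasure (ν i)]

/-- One round does not increase the sum of the expected potential and of the expected values
collected at the pull number `s + 1` of arm `j`. -/
theorem lintegral_visitPotential_step (M : IsModel P ν Y Z ξ) (a : ℕ) (rule : ArgmaxRule K S)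
    (j : Fin K) (s : ℕ) {f : ℝ → ℝ≥0∞} (hf : Measurable f) (t : ℕ) :
    ∫⁻ ω, visitPotential (ν j) s f (pulls (hist a rule (t + 1) (env Y Z ξ ω)) j)
        (cumReward (hist a rule (t + 1) (env Y Z ξ ω)) j) ∂P +
      ∫⁻ ω, (if pulledArm a rule t (env Y Z ξ ω) = j ∧
          pulls (hist a rule t (env Y Z ξ ω)) j = s then
          f (cumReward (hist a rule t (env Y Z ξ ω)) j) else 0) ∂P ≤
      ∫⁻ ω, visitPotential (ν j) s f (pulls (hist a rule t (env Y Z ξ ω)) j)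
        (cumReward (hist a rule t (env Y Z ξ ω)) j) ∂P := by
  have hpot : ∀ u, Measurable fun e : Env K S => visitPotential (ν j) s f
      (pulls (hist a rule u e) j) (cumReward (hist a rule u e) j) := fun u => by
    have h1 : Measurable fun q : ℕ × ℝ => visitPotential (ν j) s f q.1 q.2 :=
      measurable_from_prod_countable_right fun k => measurable_visitPotential (ν j) s hf k
    exact h1.comp ((measurable_pulls_hist a rule u j).prodMk (measurable_cumReward_hist a rule u j))
  have hcol : Measurable fun e : Env K S =>
      if pulledArm a rule t e = j ∧ pulls (hist a rule t e) j = s then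
        f (cumReward (hist a rule t e) j) else 0 := by
    refine Measurable.ite ?_ (hf.comp (measurable_cumReward_hist a rule t j)) measurable_const
    exact ((measurable_pulledArm a rule t) (measurableSet_singleton j)).inter
      ((measurable_pulls_hist a rule t j) (measurableSet_singleton s))
  have hcol' := hcol.comp M.measurable_env
  simp only [Function.comp_def] at hcol'
  rw [M.lintegral_setReward t (hpot (t + 1)), ← lintegral_add_right _ hcol']
  apply lintegral_mono
  intro ω
  dsimp only
  set e := env Y Z ξ ω
  have hstep : ∀ r : Fin K → ℝ, visitPotential (ν j) s f
      (pulls (hist a rule (t + 1) (setReward e t r)) j)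
      (cumReward (hist a rule (t + 1) (setReward e t r)) j) =
      if pulledArm a rule t e = j then
        visitPotential (ν j) s f (pulls (hist a rule t e) j + 1)
          (cumReward (hist a rule t e) j + r j)
      else visitPotential (ν j) s f (pulls (hist a rule t e) j)
          (cumReward (hist a rule t e) j) := by
    intro r
    have h1 : (setReward e t r).2.1 t j = r j := by simp [setReward]
    rw [pulls_hist_succ, cumReward_hist_succ, pulledArm_setReward, hist_setReward, h1]
    split_ifs <;> simp
  simp only [hstep]
  set k := pulls (hist a rule t e) j
  set v := cumReward (hist a rule t e) j
  by_cases harm : pulledArm a rule t e = j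
  swap
  · simp [harm]
  simp only [harm, if_true, true_and]
  have hlaw : ∫⁻ ω', visitPotential (ν j) s f (k + 1) (v + Y t j ω') ∂P =
      ∫⁻ x, visitPotential (ν j) s f (k + 1) (v + x) ∂(ν j) := by
    have hm : Measurable fun x => visitPotential (ν j) s f (k + 1) (v + x) :=
      (measurable_visitPotential (ν j) s hf (k + 1)).comp (by fun_prop)
    exact (lintegral_map hm (M.measurable_reward t j)).symm.trans (by rw [M.law_reward])
  rw [hlaw]
  rcases lt_trichotomy k s with h | h | h
  · rw [lintegral_visitPotential_succ (ν j) h hf v]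
    simp [h.ne]
  · rw [h, visitPotential_self (ν j) s hf]
    simp [visitPotential]
  · have h2 : ¬ k + 1 ≤ s := by omega
    simp [visitPotential, h2, h.ne']

/-- The rewards of an arm act like an i.i.d. sequence that is fixed in advance: what is collected
when arm `j` is pulled for the time number `s + 1`, or at a fixed round at which it has been pulled
`s` times, is on average at most what the sum of `s` i.i.d. rewards yields. -/
theorem sum_lintegral_visit_le (M : IsModel P ν Y Z ξ) (a : ℕ) (rule : ArgmaxRule K S)
    (j : Fin K) (s : ℕ) {f : ℝ → ℝ≥0∞} (hf : Measurable f) (n : ℕ) :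
    ∑ t ∈ Finset.range n, ∫⁻ ω, (if pulledArm a rule t (env Y Z ξ ω) = j ∧
          pulls (hist a rule t (env Y Z ξ ω)) j = s then
          f (cumReward (hist a rule t (env Y Z ξ ω)) j) else 0) ∂P +
      ∫⁻ ω, (if pulls (hist a rule n (env Y Z ξ ω)) j = s then
          f (cumReward (hist a rule n (env Y Z ξ ω)) j) else 0) ∂P ≤
      ∫⁻ x, f x ∂(sumLaw (ν j) s) := by
  have hmain : ∑ t ∈ Finset.range n, ∫⁻ ω, (if pulledArm a rule t (env Y Z ξ ω) = j ∧
          pulls (hist a rule t (env Y Z ξ ω)) j = s then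
          f (cumReward (hist a rule t (env Y Z ξ ω)) j) else 0) ∂P +
      ∫⁻ ω, visitPotential (ν j) s f (pulls (hist a rule n (env Y Z ξ ω)) j)
        (cumReward (hist a rule n (env Y Z ξ ω)) j) ∂P ≤
      ∫⁻ x, f x ∂(sumLaw (ν j) s) := by
    induction n with
    | zero => simp [visitPotential, pulls, cumReward]
    | succ n ih =>
      rw [Finset.sum_range_succ, add_assoc]
      refine le_trans ?_ ih
      gcongr
      rw [add_comm]
      exact M.lintegral_visitPotential_step a rule j s hf n
  refine le_trans ?_ hmain
  gcongr with ω
  split_ifs with h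
  · rw [h, visitPotential_self (ν j) s hf]
  · exact zero_le

end Visits

theorem measure_env_eq_lintegral_setPseudo (M : IsModel P ν Y Z ξ) (t : ℕ) (j : Fin K) {A : Set (Env K S)}
    (hA : MeasurableSet A) :
    P {ω | env Y Z ξ ω ∈ A} =
      ∫⁻ ω, P {ω' | setPseudo (env Y Z ξ ω) t j (fun l => Z t j l ω') ∈ A} ∂P := by
  have h1 : P {ω | env Y Z ξ ω ∈ A} = ∫⁻ ω, A.indicator 1 (env Y Z ξ ω) ∂P := by
    exact (lintegral_indicator_one (M.measurable_env hA)).symm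
  rw [h1, M.lintegral_setPseudo t j (measurable_one.indicator hA)]
  congr 1; ext ω
  have hm : Measurable fun ω' => setPseudo (env Y Z ξ ω) t j (fun l => Z t j l ω') :=
    (measurable_setPseudo t j).comp (measurable_const.prodMk
      (measurable_pi_iff.2 fun l => M.measurable_pseudo t j l))
  exact lintegral_indicator_one (hm hA)

/-- Given the past and the pseudo-rewards of the other arms, the estimate of arm `j` is at least
`θ / (a + 1)` with probability `exceedProb`. -/
theorem measure_le_estimates (M : IsModel P ν Y Z ξ) (a : ℕ) (rule : ArgmaxRule K S) (t : ℕ)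
    (j : Fin K) (θ : ℝ) (e : Env K S) :
    P {ω | ((θ / (a + 1) : ℝ) : EReal) ≤
        estimates a rule t (setPseudo e t j fun l => Z t j l ω) j} =
      exceedProb a θ (pulls (hist a rule t e) j) (cumReward (hist a rule t e) j) := by
  simp only [estimates, hist_setPseudo, le_estimate_iff]
  simp only [setPseudo, Function.update_self]
  exact M.measure_le_sum_pseudo t j _ _

/-- The estimate of an arm rarely exceeds the threshold in rounds in which the past rewards of the
arm make this unlikely. -/
theorem measure_exceed_le (M : IsModel P ν Y Z ξ) (a : ℕ) (rule : ArgmaxRule K S) (t : ℕ)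
    (j : Fin K) (θ : ℝ) (p : ℝ≥0∞) :
    P {ω | ((θ / (a + 1) : ℝ) : EReal) ≤ estimates a rule t (env Y Z ξ ω) j ∧
        exceedProb a θ (pulls (hist a rule t (env Y Z ξ ω)) j)
          (cumReward (hist a rule t (env Y Z ξ ω)) j) ≤ p} ≤ p := by
  have hA : MeasurableSet {e : Env K S | ((θ / (a + 1) : ℝ) : EReal) ≤ estimates a rule t e j ∧
      exceedProb a θ (pulls (hist a rule t e) j) (cumReward (hist a rule t e) j) ≤ p} :=
    (measurableSet_le measurable_const (measurable_estimates a rule t j)).inter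
      (measurableSet_le (measurable_comp_hist a rule t j (measurable_exceedProb a θ))
        measurable_const)
  refine (M.measure_env_eq_lintegral_setPseudo t j hA).trans_le ?_
  calc _ ≤ ∫⁻ _, p ∂P := by
        apply lintegral_mono
        intro ω
        simp only [Set.mem_ofPred_eq, hist_setPseudo]
        set e := env Y Z ξ ω
        by_cases he : exceedProb a θ (pulls (hist a rule t e) j)
            (cumReward (hist a rule t e) j) ≤ p
        · simp only [he, and_true]
          rw [M.measure_le_estimates a rule t j θ e]
          exact he
        · simp [he]
    _ = p := by simp

/-- The exploration argument. Given the past and the pseudo-rewards of the arms other than `opt`,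
a round in which all estimates are below the threshold becomes a pull of `opt` as soon as the
estimate of `opt` is lifted above it, so the odds of the former against the latter are at most
`(1 - q) / q = q⁻¹ - 1` with `q = exceedProb`. The sets `G s` restrict the cumulative reward of
`opt` after `s` pulls, and exclude `q = 0`. -/
theorem measure_below_le (M : IsModel P ν Y Z ξ) (a : ℕ) (rule : ArgmaxRule K S) (t : ℕ)
    (opt i : Fin K) (θ : ℝ) {G : ℕ → Set ℝ} (hG : ∀ s, MeasurableSet (G s))
    (hG0 : ∀ s, ∀ v ∈ G s, exceedProb a θ s v ≠ 0) :
    P {ω | pulledArm a rule t (env Y Z ξ ω) = i ∧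
        estimates a rule t (env Y Z ξ ω) i < ((θ / (a + 1) : ℝ) : EReal) ∧
        cumReward (hist a rule t (env Y Z ξ ω)) opt ∈
          G (pulls (hist a rule t (env Y Z ξ ω)) opt)} ≤
      ∫⁻ ω, (if pulledArm a rule t (env Y Z ξ ω) = opt then
        (G (pulls (hist a rule t (env Y Z ξ ω)) opt)).indicator
          (fun v => (exceedProb a θ (pulls (hist a rule t (env Y Z ξ ω)) opt) v)⁻¹ - 1)
          (cumReward (hist a rule t (env Y Z ξ ω)) opt) else 0) ∂P := by
  set τ : EReal := ((θ / (a + 1) : ℝ) : EReal)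
  set r : ℕ → ℝ → ℝ≥0∞ := fun s => (G s).indicator fun v => (exceedProb a θ s v)⁻¹ - 1 with hr
  have hrm : ∀ s, Measurable (r s) := fun s =>
    ((measurable_exceedProb a θ s).inv.sub_const 1).indicator (hG s)
  have hGm : MeasurableSet {e : Env K S | cumReward (hist a rule t e) opt ∈
      G (pulls (hist a rule t e) opt)} := by
    have h := measurable_comp_hist a rule t opt (g := fun s => (G s).indicator 1)
      (fun s => measurable_one.indicator (hG s))
    have h2 := h (measurableSet_singleton 1)
    convert h2 using 1
    ext e
    simp [Set.indicator]
  have hA : MeasurableSet {e : Env K S | pulledArm a rule t e = i ∧ estimates a rule t e i < τ ∧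
      cumReward (hist a rule t e) opt ∈ G (pulls (hist a rule t e) opt)} :=
    ((measurable_pulledArm a rule t) (measurableSet_singleton i)).inter
      ((measurableSet_lt (measurable_estimates a rule t i) measurable_const).inter hGm)
  have hF : Measurable fun e : Env K S => if pulledArm a rule t e = opt then
      r (pulls (hist a rule t e) opt) (cumReward (hist a rule t e) opt) else 0 :=
    Measurable.ite ((measurable_pulledArm a rule t) (measurableSet_singleton opt))
      (measurable_comp_hist a rule t opt hrm) measurable_const
  refine (M.measure_env_eq_lintegral_setPseudo t opt hA).trans_le
    (le_trans ?_ (M.lintegral_setPseudo t opt hF).ge)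
  apply lintegral_mono
  intro ω
  simp only [Set.mem_ofPred_eq, hist_setPseudo]
  set e := env Y Z ξ ω
  set s := pulls (hist a rule t e) opt
  set v := cumReward (hist a rule t e) opt
  set E := fun ω' => setPseudo e t opt fun l => Z t opt l ω'
  set q := exceedProb a θ s v with hq
  by_cases hGe : v ∈ G s
  swap
  · simp [hGe]
  by_cases hC : ∀ k, k ≠ opt → estimates a rule t e k < τ
  swap
  · have : {ω' | pulledArm a rule t (E ω') = i ∧ estimates a rule t (E ω') i < τ ∧ v ∈ G s} = ∅ := by
      refine Set.eq_empty_of_forall_notMem fun ω' h => hC fun k hk => ?_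
      have h1 := estimates_le_pulledArm a rule t (E ω') k
      rw [h.1] at h1
      rw [← estimates_setPseudo_of_ne a rule t e hk fun l => Z t opt l ω']
      exact h1.trans_lt h.2.1
    change P {ω' | pulledArm a rule t (E ω') = i ∧ estimates a rule t (E ω') i < τ ∧ v ∈ G s} ≤ _
    rw [this]
    simp
  have hEm : Measurable E := (measurable_setPseudo t opt).comp (measurable_const.prodMk
      (measurable_pi_iff.2 fun l => M.measurable_pseudo t opt l))
  have hBm : MeasurableSet {ω' | τ ≤ estimates a rule t (E ω') opt} :=
    measurableSet_le measurable_const ((measurable_estimates a rule t opt).comp hEm)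
  have hBq : P {ω' | τ ≤ estimates a rule t (E ω') opt} = q :=
    M.measure_le_estimates a rule t opt θ e
  have hq0 : q ≠ 0 := hG0 s v hGe
  have hqtop : q ≠ ⊤ := ((exceedProb_le_one a θ s v).trans_lt ENNReal.one_lt_top).ne
  calc P {ω' | pulledArm a rule t (E ω') = i ∧ estimates a rule t (E ω') i < τ ∧ v ∈ G s}
      ≤ P {ω' | τ ≤ estimates a rule t (E ω') opt}ᶜ := by
        apply measure_mono
        intro ω' h h2
        have h1 := estimates_le_pulledArm a rule t (E ω') opt
        rw [h.1] at h1
        exact absurd h.2.1 (not_lt.2 (le_trans h2 h1))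
    _ = 1 - q := by rw [prob_compl_eq_one_sub hBm, hBq]
    _ = r s v * q := by
        simp only [r, Set.indicator_of_mem hGe, ← hq]
        rw [ENNReal.sub_mul (fun _ _ => hqtop), ENNReal.inv_mul_cancel hq0 hqtop, one_mul]
    _ = ∫⁻ ω', {ω' | τ ≤ estimates a rule t (E ω') opt}.indicator (fun _ => r s v) ω' ∂P := by
        rw [lintegral_indicator_const hBm, hBq]
    _ ≤ ∫⁻ ω', (if pulledArm a rule t (E ω') = opt then r s v else 0) ∂P := by
        apply lintegral_mono
        intro ω'
        by_cases h : τ ≤ estimates a rule t (E ω') opt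
        · have hp : pulledArm a rule t (E ω') = opt := by
            by_contra hne
            have h1 := estimates_le_pulledArm a rule t (E ω') opt
            have h2 := hC _ hne
            rw [← estimates_setPseudo_of_ne a rule t e hne fun l => Z t opt l ω'] at h2
            exact absurd h2 (not_lt.2 (h.trans h1))
          simp [hp, Set.indicator, h]
        · simp [Set.indicator, h]

end IsModel

/-! ### Counting the pulls of a suboptimal arm -/

/-- Summation of the contributions of the pull numbers `s`: negligible beyond `L`, and at most `C`
each up to `L`. -/
theorem sum_range_le_of_threshold {x : ℕ → ℝ≥0∞} {n : ℕ} {L C : ℝ} (hL : 0 ≤ L)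
    (h1 : ∀ s : ℕ, 0 < s → (s : ℝ) ≤ L → x s ≤ ENNReal.ofReal C)
    (h2 : ∀ s : ℕ, s < n → L < s → x s ≤ (n : ℝ≥0∞)⁻¹) :
    ∑ s ∈ Finset.range n, x s ≤ x 0 + ENNReal.ofReal (C * L) + 1 := by
  calc ∑ s ∈ Finset.range n, x s
      ≤ ∑ s ∈ Finset.range n, ((if s = 0 then x 0 else 0) +
          (if s ∈ Finset.Icc 1 ⌊L⌋₊ then ENNReal.ofReal C else 0) + (n : ℝ≥0∞)⁻¹) := by
        refine Finset.sum_le_sum fun s hs => ?_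
        rcases Nat.eq_zero_or_pos s with rfl | hpos
        · simp only [if_true, add_assoc]; exact le_self_add
        · by_cases hsL : (s : ℝ) ≤ L
          · have hmem : s ∈ Finset.Icc 1 ⌊L⌋₊ := Finset.mem_Icc.2 ⟨hpos, Nat.le_floor hsL⟩
            simp only [hmem, if_true]
            exact (h1 s hpos hsL).trans (le_add_self.trans le_self_add)
          · exact (h2 s (Finset.mem_range.1 hs) (not_le.1 hsL)).trans le_add_self
    _ = ∑ s ∈ Finset.range n, (if s = 0 then x 0 else 0) +
          ∑ s ∈ Finset.range n, (if s ∈ Finset.Icc 1 ⌊L⌋₊ then ENNReal.ofReal C else 0) +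
          n * (n : ℝ≥0∞)⁻¹ := by
        rw [Finset.sum_add_distrib, Finset.sum_add_distrib]
        simp
    _ ≤ _ := by
        gcongr
        · rw [Finset.sum_ite_eq']
          split_ifs
          · exact le_rfl
          · exact zero_le
        · rw [← Finset.sum_filter, Finset.sum_const, nsmul_eq_mul, mul_comm C L,
            ENNReal.ofReal_mul hL]
          gcongr
          have hcard : (Finset.filter (fun s => s ∈ Finset.Icc 1 ⌊L⌋₊) (Finset.range n)).card ≤
              ⌊L⌋₊ := by
            calc _ ≤ (Finset.Icc 1 ⌊L⌋₊).card := by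
                  apply Finset.card_le_card
                  intro s hs
                  exact (Finset.mem_filter.1 hs).2
              _ = _ := by simp
          rw [← ENNReal.ofReal_natCast]
          apply ENNReal.ofReal_le_ofReal
          exact le_trans (by exact_mod_cast hcard) (Nat.floor_le hL)
        · exact ENNReal.mul_inv_le_one _

theorem ofReal_exp_neg_le_inv {n : ℕ} (hn : 0 < n) {x : ℝ} (hx : Real.log n ≤ x) :
    ENNReal.ofReal (Real.exp (-x)) ≤ (n : ℝ≥0∞)⁻¹ := by
  have hn' : (0 : ℝ) < n := by exact_mod_cast hn
  rw [← ENNReal.ofReal_natCast, ← ENNReal.ofReal_inv_of_pos hn']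
  apply ENNReal.ofReal_le_ofReal
  rw [Real.exp_neg]
  apply inv_anti₀ hn'
  rwa [← Real.log_le_iff_le_exp hn']

theorem exceedProb_le {a s : ℕ} (ha : 0 < a) (hs : 0 < s) {θ v u : ℝ} (hu : 0 ≤ u)
    (h : a * s / 2 + u ≤ θ * s - v) :
    exceedProb a θ s v ≤ ENNReal.ofReal (Real.exp (-(2 * u ^ 2 / (a * s)))) := by
  have h1 := sumLaw_tail_le fairBernoulli_ae_mem (Nat.mul_pos ha hs) hu (e := 1) (by norm_num)
  rw [integral_fairBernoulli] at h1
  push_cast at h1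
  refine le_trans (measure_mono fun x hx => ?_) h1
  have hx' : θ * s - v ≤ x := hx
  simp only [Set.mem_ofPred_eq]
  linarith

theorem one_sub_exceedProb_le {a s : ℕ} (ha : 0 < a) (hs : 0 < s) {θ v u : ℝ} (hu : 0 ≤ u)
    (h : θ * s - v ≤ a * s / 2 - u) :
    1 - exceedProb a θ s v ≤ ENNReal.ofReal (Real.exp (-(2 * u ^ 2 / (a * s)))) := by
  have h1 := sumLaw_tail_le fairBernoulli_ae_mem (Nat.mul_pos ha hs) hu (e := -1) (by norm_num)
  rw [integral_fairBernoulli] at h1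
  push_cast at h1
  rw [exceedProb, ← prob_compl_eq_one_sub measurableSet_Ici]
  refine le_trans (measure_mono fun x hx => ?_) h1
  have hx' : x < θ * s - v := by simpa using hx
  simp only [Set.mem_ofPred_eq]
  linarith

theorem exceedProb_zero (a : ℕ) (θ : ℝ) : exceedProb a θ 0 0 = 1 := by
  simp [exceedProb, sumLaw]

theorem boundConst_nonneg (a : ℝ) : 0 ≤ boundConst a := by
  unfold boundConst
  positivity

namespace IsModel

variable {K : ℕ} {Ω S : Type*} [MeasurableSpace Ω] [MeasurableSpace S]
  {P : Measure Ω} [IsProbabilityMeasure P] {ν : Fin K → Measure ℝ}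
  [∀ i, IsProbabilityMeasure (ν i)] {Y : ℕ → Fin K → Ω → ℝ}
  {Z : ℕ → Fin K → ℕ → Ω → ℝ} {ξ : Ω → S}

theorem sum_lintegral_pull_le (M : IsModel P ν Y Z ξ) (a : ℕ) (rule : ArgmaxRule K S)
    (j : Fin K) {f : ℕ → ℝ → ℝ≥0∞} (hf : ∀ s, Measurable (f s)) (n : ℕ) :
    ∑ t ∈ Finset.range n, ∫⁻ ω, (if pulledArm a rule t (env Y Z ξ ω) = j then
        f (pulls (hist a rule t (env Y Z ξ ω)) j)
          (cumReward (hist a rule t (env Y Z ξ ω)) j) else 0) ∂P ≤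
      ∑ s ∈ Finset.range n, ∫⁻ x, f s x ∂(sumLaw (ν j) s) := by
  have hm : ∀ s t, Measurable fun ω => if pulledArm a rule t (env Y Z ξ ω) = j ∧
      pulls (hist a rule t (env Y Z ξ ω)) j = s then
      f s (cumReward (hist a rule t (env Y Z ξ ω)) j) else 0 := fun s t => by
    have h1 : Measurable fun e : Env K S => if pulledArm a rule t e = j ∧
        pulls (hist a rule t e) j = s then f s (cumReward (hist a rule t e) j) else 0 :=
      Measurable.ite (((measurable_pulledArm a rule t) (measurableSet_singleton j)).inter
        ((measurable_pulls_hist a rule t j) (measurableSet_singleton s)))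
        ((hf s).comp (measurable_cumReward_hist a rule t j)) measurable_const
    exact h1.comp M.measurable_env
  calc _ ≤ ∑ t ∈ Finset.range n, ∑ s ∈ Finset.range n,
        ∫⁻ ω, (if pulledArm a rule t (env Y Z ξ ω) = j ∧
          pulls (hist a rule t (env Y Z ξ ω)) j = s then
          f s (cumReward (hist a rule t (env Y Z ξ ω)) j) else 0) ∂P := by
        refine Finset.sum_le_sum fun t ht => ?_
        rw [← lintegral_finsetSum _ fun s _ => hm s t]
        apply lintegral_mono
        intro ω
        have hs : pulls (hist a rule t (env Y Z ξ ω)) j ∈ Finset.range n :=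
          Finset.mem_range.2 ((pulls_le _ j).trans_lt (Finset.mem_range.1 ht))
        refine le_trans ?_ (Finset.single_le_sum (fun _ _ => zero_le) hs)
        simp
    _ = ∑ s ∈ Finset.range n, ∑ t ∈ Finset.range n,
        ∫⁻ ω, (if pulledArm a rule t (env Y Z ξ ω) = j ∧
          pulls (hist a rule t (env Y Z ξ ω)) j = s then
          f s (cumReward (hist a rule t (env Y Z ξ ω)) j) else 0) ∂P := Finset.sum_comm
    _ ≤ _ := Finset.sum_le_sum fun s _ =>
        le_self_add.trans (M.sum_lintegral_visit_le a rule j s (hf s) n)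

/-- A union bound over the number of pulls of arm `j` in round `t`. -/
theorem measure_cumReward_le (M : IsModel P ν Y Z ξ) (a : ℕ) (rule : ArgmaxRule K S)
    (j : Fin K) {B : ℕ → Set ℝ} (hB : ∀ s, MeasurableSet (B s)) {n t : ℕ} (ht : t < n) :
    P {ω | cumReward (hist a rule t (env Y Z ξ ω)) j ∈
        B (pulls (hist a rule t (env Y Z ξ ω)) j)} ≤
      ∑ s ∈ Finset.range n, sumLaw (ν j) s (B s) := by
  calc _ ≤ P (⋃ s ∈ Finset.range n, {ω | pulls (hist a rule t (env Y Z ξ ω)) j = s ∧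
          cumReward (hist a rule t (env Y Z ξ ω)) j ∈ B s}) := by
        apply measure_mono
        intro ω hω
        simp only [Set.mem_iUnion]
        exact ⟨_, Finset.mem_range.2 ((pulls_le _ j).trans_lt ht), rfl, hω⟩
    _ ≤ ∑ s ∈ Finset.range n, P {ω | pulls (hist a rule t (env Y Z ξ ω)) j = s ∧
          cumReward (hist a rule t (env Y Z ξ ω)) j ∈ B s} := measure_biUnion_finset_le _ _
    _ ≤ _ := by
        refine Finset.sum_le_sum fun s _ => ?_
        have h := le_add_self.trans (M.sum_lintegral_visit_le a rule j s
          (measurable_one.indicator (hB s)) t)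
        rw [lintegral_indicator_one (hB s)] at h
        refine le_trans ?_ h
        have hE : MeasurableSet {e : Env K S | pulls (hist a rule t e) j = s ∧
            cumReward (hist a rule t e) j ∈ B s} :=
          ((measurable_pulls_hist a rule t j) (measurableSet_singleton s)).inter
            ((measurable_cumReward_hist a rule t j) (hB s))
        refine (lintegral_indicator_one (M.measurable_env hE)).symm.trans_le ?_
        apply lintegral_mono
        intro ω
        by_cases hω : ω ∈ env Y Z ξ ⁻¹' {e | pulls (hist a rule t e) j = s ∧
            cumReward (hist a rule t e) j ∈ B s}
        swap
        · rw [Set.indicator_of_notMem hω]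
          exact zero_le
        have h1 : pulls (hist a rule t (env Y Z ξ ω)) j = s := hω.1
        have h2 : cumReward (hist a rule t (env Y Z ξ ω)) j ∈ B s := hω.2
        rw [Set.indicator_of_mem hω]
        simp [h1, h2]

/-- Pulls of an arm whose estimate is too high: after more than `8 * a / d ^ 2 * log n` pulls
neither its rewards nor the perturbations are likely to bridge half of the gap `d`. -/
theorem sum_measure_above_le (M : IsModel P ν Y Z ξ) {a : ℕ} (ha : 2 < a) (rule : ArgmaxRule K S)
    (i : Fin K) (hν : ∀ᵐ x ∂(ν i), x ∈ Set.Icc (0 : ℝ) 1) {d : ℝ} (hd : 0 < d) {n : ℕ}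
    (hn : 0 < n) :
    ∑ t ∈ Finset.range n, P {ω | pulledArm a rule t (env Y Z ξ ω) = i ∧
        (((mean ν i + d / 2 + a / 2) / (a + 1) : ℝ) : EReal) ≤
          estimates a rule t (env Y Z ξ ω) i} ≤
      ENNReal.ofReal (8 * a / d ^ 2 * Real.log n + 3) := by
  set θ := mean ν i + d / 2 + a / 2 with hθ
  have ha' : (3 : ℝ) ≤ a := by exact_mod_cast ha
  have hlog : 0 ≤ Real.log n := Real.log_natCast_nonneg n
  set L := 8 * a / d ^ 2 * Real.log n with hLdef
  have hL : 0 ≤ L := by positivity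
  set B : ℕ → Set ℝ := fun s => {v | (n : ℝ≥0∞)⁻¹ < exceedProb a θ s v} with hBdef
  have hB : ∀ s, MeasurableSet (B s) := fun s =>
    measurableSet_lt measurable_const (measurable_exceedProb a θ s)
  have hsplit : ∀ t, P {ω | pulledArm a rule t (env Y Z ξ ω) = i ∧ ((θ / (a + 1) : ℝ) : EReal) ≤
      estimates a rule t (env Y Z ξ ω) i} ≤ (n : ℝ≥0∞)⁻¹ +
      ∫⁻ ω, (if pulledArm a rule t (env Y Z ξ ω) = i then
        (B (pulls (hist a rule t (env Y Z ξ ω)) i)).indicator 1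
          (cumReward (hist a rule t (env Y Z ξ ω)) i) else 0) ∂P := by
    intro t
    have hE : MeasurableSet {e : Env K S | pulledArm a rule t e = i ∧
        cumReward (hist a rule t e) i ∈ B (pulls (hist a rule t e) i)} :=
      ((measurable_pulledArm a rule t) (measurableSet_singleton i)).inter
        (measurableSet_lt measurable_const
          (measurable_comp_hist a rule t i (measurable_exceedProb a θ)))
    have h1 : ∫⁻ ω, (if pulledArm a rule t (env Y Z ξ ω) = i then
        (B (pulls (hist a rule t (env Y Z ξ ω)) i)).indicator 1
          (cumReward (hist a rule t (env Y Z ξ ω)) i) else 0) ∂P =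
        P {ω | pulledArm a rule t (env Y Z ξ ω) = i ∧ cumReward (hist a rule t (env Y Z ξ ω)) i ∈
          B (pulls (hist a rule t (env Y Z ξ ω)) i)} := by
      refine Eq.trans ?_ (lintegral_indicator_one (M.measurable_env hE))
      congr 1; ext ω
      by_cases h1 : pulledArm a rule t (env Y Z ξ ω) = i <;> simp [Set.indicator, h1]
    rw [h1]
    refine le_trans ?_ (add_le_add_left (M.measure_exceed_le a rule t i θ (n : ℝ≥0∞)⁻¹) _)
    refine le_trans (measure_mono fun ω hω => ?_) (measure_union_le _ _)
    by_cases h : exceedProb a θ (pulls (hist a rule t (env Y Z ξ ω)) i)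
          (cumReward (hist a rule t (env Y Z ξ ω)) i) ≤ (n : ℝ≥0∞)⁻¹
    · exact Or.inl ⟨hω.2, h⟩
    · exact Or.inr ⟨hω.1, not_le.1 h⟩
  have hvisit := M.sum_lintegral_pull_le a rule i (f := fun s => (B s).indicator 1)
    (fun s => measurable_one.indicator (hB s)) n
  have hthr : ∑ s ∈ Finset.range n, sumLaw (ν i) s (B s) ≤ 1 + ENNReal.ofReal (1 * L) + 1 := by
    refine (sum_range_le_of_threshold hL ?_ ?_).trans
      (add_le_add_left (add_le_add_left (prob_le_one (μ := sumLaw (ν i) 0)) _) _)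
    · intro s _ _
      simpa using prob_le_one
    · intro s _ hs
      have hs0 : (0 : ℝ) < s := hL.trans_lt hs
      have hspos : 0 < s := by exact_mod_cast hs0
      have hls : Real.log n ≤ s * d ^ 2 / (8 * a) := by
        rw [hLdef] at hs
        rw [le_div_iff₀ (by positivity)]
        have h2 : 8 * a / d ^ 2 * Real.log n * d ^ 2 ≤ s * d ^ 2 :=
          mul_le_mul_of_nonneg_right hs.le (by positivity)
        have h3 : 8 * a / d ^ 2 * Real.log n * d ^ 2 = Real.log n * (8 * a) := by
          field_simp
        linarith
      have htail := sumLaw_tail_le hν hspos (u := s * d / 4) (by positivity) (e := 1) (by norm_num)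
      calc sumLaw (ν i) s (B s)
          ≤ sumLaw (ν i) s {x | s * d / 4 ≤ 1 * (x - s * ∫ y, y ∂(ν i))} := by
            apply measure_mono
            intro v hv
            by_contra hcon
            simp only [Set.mem_ofPred_eq, one_mul, not_le] at hcon
            refine absurd (show (n : ℝ≥0∞)⁻¹ < exceedProb a θ s v from hv) (not_lt.2 ?_)
            refine (exceedProb_le (u := s * d / 4) (by omega) hspos (by positivity) ?_).trans
              (ofReal_exp_neg_le_inv hn ?_)
            · rw [hθ, mean]
              linarith
            · refine hls.trans (le_of_eq ?_)
              field_simp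
              ring
        _ ≤ _ := htail
        _ ≤ _ := by
            refine ofReal_exp_neg_le_inv hn (hls.trans ?_)
            rw [div_le_div_iff₀ (by positivity) hs0]
            have : (0 : ℝ) ≤ s ^ 2 * d ^ 2 := by positivity
            nlinarith
  calc _ ≤ ∑ t ∈ Finset.range n, ((n : ℝ≥0∞)⁻¹ +
      ∫⁻ ω, (if pulledArm a rule t (env Y Z ξ ω) = i then
        (B (pulls (hist a rule t (env Y Z ξ ω)) i)).indicator 1
          (cumReward (hist a rule t (env Y Z ξ ω)) i) else 0) ∂P) :=
        Finset.sum_le_sum fun t _ => hsplit t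
    _ ≤ 1 + ∑ s ∈ Finset.range n, sumLaw (ν i) s (B s) := by
        rw [Finset.sum_add_distrib]
        refine add_le_add ?_ ?_
        · simp only [Finset.sum_const, Finset.card_range, nsmul_eq_mul]
          exact ENNReal.mul_inv_le_one _
        · refine hvisit.trans (le_of_eq ?_)
          simp only [lintegral_indicator_one (hB _)]
    _ ≤ 1 + (1 + ENNReal.ofReal (1 * L) + 1) := by gcongr
    _ = _ := by
        rw [one_mul, ENNReal.ofReal_add hL (by norm_num)]
        have : ENNReal.ofReal 3 = 3 := by simp
        rw [this]
        ring

/-- Pulls of an arm while its estimate is not too high: the perturbations lift the estimate of the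
optimal arm often enough, by `lintegral_inv_tail_le` for up to `16 * a / d ^ 2 * log n` pulls of the
optimal arm, and almost always thereafter. -/
theorem sum_measure_below_le (M : IsModel P ν Y Z ξ) {a : ℕ} (ha : 2 < a) (rule : ArgmaxRule K S)
    (opt i : Fin K) (hν : ∀ᵐ x ∂(ν opt), x ∈ Set.Icc (0 : ℝ) 1) {d : ℝ} (hd : 0 < d) {n : ℕ}
    (hn : 0 < n) :
    ∑ t ∈ Finset.range n, P {ω | pulledArm a rule t (env Y Z ξ ω) = i ∧
        estimates a rule t (env Y Z ξ ω) i <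
          (((mean ν opt - d / 2 + a / 2) / (a + 1) : ℝ) : EReal)} ≤
      ENNReal.ofReal (16 * a * boundConst a / d ^ 2 * Real.log n + 2) := by
  set θ := mean ν opt - d / 2 + a / 2 with hθ
  have ha' : (3 : ℝ) ≤ a := by exact_mod_cast ha
  have hlog : 0 ≤ Real.log n := Real.log_natCast_nonneg n
  set L := 16 * a / d ^ 2 * Real.log n with hLdef
  have hL : 0 ≤ L := by positivity
  have hc := boundConst_nonneg a
  set G : ℕ → Set ℝ := fun s =>
    {v | exceedProb a θ s v ≠ 0 ∧ (L < s → s * mean ν opt - s * d / 4 ≤ v)} with hGdef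
  have hG : ∀ s, MeasurableSet (G s) := fun s => by
    refine ((measurable_exceedProb a θ s) (measurableSet_singleton 0).compl).inter ?_
    by_cases h : L < s
    · simp only [h, forall_const]; exact measurableSet_le measurable_const measurable_id
    · simp only [h, false_imp_iff]; exact MeasurableSet.const True
  have hinv : ∀ s : ℕ, 0 < s → ∫⁻ v, (exceedProb a θ s v)⁻¹ ∂(sumLaw (ν opt) s) ≤
      ENNReal.ofReal (boundConst a) := fun s hs =>
    lintegral_inv_tail_le hν ha hs (by rw [hθ, mean]; linarith)
  have hls : ∀ s : ℕ, L < s → Real.log (n ^ 2 : ℕ) ≤ s * d ^ 2 / (8 * a) := fun s hs => by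
    rw [hLdef] at hs
    push_cast
    rw [Real.log_pow, le_div_iff₀ (by positivity)]
    have h2 : 16 * a / d ^ 2 * Real.log n * d ^ 2 ≤ s * d ^ 2 :=
      mul_le_mul_of_nonneg_right hs.le (by positivity)
    have h3 : 16 * a / d ^ 2 * Real.log n * d ^ 2 = (2 : ℕ) * Real.log n * (8 * a) := by
      field_simp; push_cast; ring
    rw [h3] at h2
    exact h2
  -- the rewards of the optimal arm are rarely exceptional; the bound `n⁻²` allows for a union
  -- bound over the round and over the number of pulls
  have hbad : ∀ s, sumLaw (ν opt) s (G s)ᶜ ≤ ((n ^ 2 : ℕ) : ℝ≥0∞)⁻¹ := by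
    intro s
    rcases Nat.eq_zero_or_pos s with rfl | hspos
    · have h0 : (0 : ℝ) ∈ G 0 := by simp [hGdef, exceedProb_zero]
      rw [sumLaw, Measure.dirac_apply' _ (hG 0).compl]
      simp [h0]
    have hs0 : (0 : ℝ) < s := by exact_mod_cast hspos
    have hzero : sumLaw (ν opt) s {v | exceedProb a θ s v = 0} = 0 := by
      have h := ae_lt_top (measurable_exceedProb a θ s).inv
        ((hinv s hspos).trans_lt ENNReal.ofReal_lt_top).ne
      rw [ae_iff] at h
      refine measure_mono_null (fun v hv => ?_) h
      have hv' : exceedProb a θ s v = 0 := hv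
      simp [hv']
    by_cases hLs : L < s
    · calc sumLaw (ν opt) s (G s)ᶜ
          ≤ sumLaw (ν opt) s ({v | exceedProb a θ s v = 0} ∪
              {x | s * d / 4 ≤ -1 * (x - s * ∫ y, y ∂(ν opt))}) := by
            apply measure_mono
            intro v hv
            by_contra hcon
            simp only [Set.mem_union, Set.mem_ofPred_eq, not_or, not_le] at hcon
            refine hv ⟨hcon.1, fun _ => ?_⟩
            rw [mean]
            linarith [hcon.2]
        _ ≤ _ := measure_union_le _ _
        _ ≤ 0 + ENNReal.ofReal (Real.exp (-(2 * (s * d / 4) ^ 2 / s))) := by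
            rw [hzero]
            gcongr
            exact sumLaw_tail_le hν hspos (by positivity) (by norm_num)
        _ ≤ _ := by
            rw [zero_add]
            refine ofReal_exp_neg_le_inv (by positivity) ((hls s hLs).trans ?_)
            rw [div_le_div_iff₀ (by positivity) hs0]
            have : (0 : ℝ) ≤ s ^ 2 * d ^ 2 := by positivity
            nlinarith
    · refine le_trans (le_of_eq ?_) zero_le
      refine measure_mono_null (fun v hv => ?_) hzero
      by_contra hcon
      exact hv ⟨hcon, fun h => absurd h hLs⟩
  set r : ℕ → ℝ → ℝ≥0∞ := fun s => (G s).indicator fun v => (exceedProb a θ s v)⁻¹ - 1 with hr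
  have hrm : ∀ s, Measurable (r s) := fun s =>
    ((measurable_exceedProb a θ s).inv.sub_const 1).indicator (hG s)
  have hthr : ∑ s ∈ Finset.range n, ∫⁻ v, r s v ∂(sumLaw (ν opt) s) ≤
      0 + ENNReal.ofReal (boundConst a * L) + 1 := by
    have h0 : ∫⁻ v, r 0 v ∂(sumLaw (ν opt) 0) = 0 := by
      rw [sumLaw, lintegral_dirac' _ (hrm 0)]
      simp [hr, Set.indicator, exceedProb_zero]
    have h := sum_range_le_of_threshold (x := fun s => ∫⁻ v, r s v ∂(sumLaw (ν opt) s)) (n := n)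
      (C := boundConst a) hL ?_ ?_
    · simpa only [h0] using h
    · intro s hs _
      refine (lintegral_mono fun v => ?_).trans (hinv s hs)
      exact Set.indicator_le' (fun _ _ => tsub_le_self) (fun _ _ => zero_le) v
    · intro s hsn hs
      have hs0 : (0 : ℝ) < s := hL.trans_lt hs
      have hspos : 0 < s := by exact_mod_cast hs0
      have hn2 : 2 ≤ n := by omega
      have hpt : ∀ v, r s v ≤ (n : ℝ≥0∞)⁻¹ := by
        intro v
        by_cases hv : v ∈ G s
        swap
        · simp [hr, hv]
        simp only [hr, Set.indicator_of_mem hv]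
        have hv2 := hv.2 hs
        have h1 : 1 - exceedProb a θ s v ≤ ((n ^ 2 : ℕ) : ℝ≥0∞)⁻¹ := by
          refine (one_sub_exceedProb_le (u := s * d / 4) (by omega) hspos (by positivity) ?_).trans
            (ofReal_exp_neg_le_inv (by positivity) ((hls s hs).trans (le_of_eq ?_)))
          · rw [hθ]
            linarith
          · field_simp
            ring
        have hq1 := exceedProb_le_one a θ s v
        -- `1 / q - 1 ≤ 1 / n` follows from `q ≥ 1 - 1 / n ^ 2` as `n ≥ 2`
        have hqtop : exceedProb a θ s v ≠ ⊤ := (hq1.trans_lt ENNReal.one_lt_top).ne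
        obtain ⟨q, hq, hqe⟩ : ∃ q : ℝ, 0 ≤ q ∧ exceedProb a θ s v = ENNReal.ofReal q :=
          ⟨_, ENNReal.toReal_nonneg, (ENNReal.ofReal_toReal hqtop).symm⟩
        have hn2' : (2 : ℝ) ≤ n := by exact_mod_cast hn2
        rw [hqe, ← ENNReal.ofReal_one, ← ENNReal.ofReal_sub _ hq, ← ENNReal.ofReal_natCast,
          ← ENNReal.ofReal_inv_of_pos (by positivity),
          ENNReal.ofReal_le_ofReal_iff (by positivity)] at h1
        push_cast at h1
        have hsq : ((n : ℝ) ^ 2)⁻¹ ≤ 1 / 4 := by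
          rw [inv_le_comm₀ (by positivity) (by norm_num)]
          norm_num
          nlinarith
        have hqpos : 0 < q := by linarith
        rw [hqe, ← ENNReal.ofReal_inv_of_pos hqpos, ← ENNReal.ofReal_one,
          ← ENNReal.ofReal_sub _ zero_le_one, ← ENNReal.ofReal_natCast,
          ← ENNReal.ofReal_inv_of_pos (by positivity)]
        apply ENNReal.ofReal_le_ofReal
        have hq2 : 1 ≤ q * (1 + (n : ℝ)⁻¹) := by
          have h5 : 1 - ((n : ℝ) ^ 2)⁻¹ ≤ q := by linarith
          have h6 : 0 < (n : ℝ)⁻¹ := by positivity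
          have h7 : ((n : ℝ) ^ 2)⁻¹ = (n : ℝ)⁻¹ * (n : ℝ)⁻¹ := by rw [← mul_inv, sq]
          have h8 : (n : ℝ)⁻¹ ≤ 1 / 2 := by
            rw [inv_le_comm₀ (by positivity) (by norm_num)]
            norm_num
            linarith
          rw [h7] at h5
          set x := (n : ℝ)⁻¹
          calc 1 ≤ (1 - x * x) * (1 + x) := by nlinarith
            _ ≤ q * (1 + x) := by gcongr
        have : q⁻¹ ≤ 1 + (n : ℝ)⁻¹ := by
          rw [inv_le_iff_one_le_mul₀ hqpos]
          linarith
        linarith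
      calc _ ≤ ∫⁻ _, (n : ℝ≥0∞)⁻¹ ∂(sumLaw (ν opt) s) := lintegral_mono hpt
        _ = _ := by simp
  have hsplit : ∀ t, P {ω | pulledArm a rule t (env Y Z ξ ω) = i ∧
      estimates a rule t (env Y Z ξ ω) i < ((θ / (a + 1) : ℝ) : EReal)} ≤
      ∫⁻ ω, (if pulledArm a rule t (env Y Z ξ ω) = opt then
        r (pulls (hist a rule t (env Y Z ξ ω)) opt)
          (cumReward (hist a rule t (env Y Z ξ ω)) opt) else 0) ∂P +
      P {ω | cumReward (hist a rule t (env Y Z ξ ω)) opt ∈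
        (G (pulls (hist a rule t (env Y Z ξ ω)) opt))ᶜ} := by
    intro t
    refine le_trans ?_ (add_le_add_left
      (M.measure_below_le a rule t opt i θ hG fun s v hv => hv.1) _)
    refine le_trans (measure_mono fun ω hω => ?_) (measure_union_le _ _)
    by_cases h : cumReward (hist a rule t (env Y Z ξ ω)) opt ∈
        G (pulls (hist a rule t (env Y Z ξ ω)) opt)
    · exact Or.inl ⟨hω.1, hω.2, h⟩
    · exact Or.inr h
  calc _ ≤ ∑ t ∈ Finset.range n, (∫⁻ ω, (if pulledArm a rule t (env Y Z ξ ω) = opt then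
        r (pulls (hist a rule t (env Y Z ξ ω)) opt)
          (cumReward (hist a rule t (env Y Z ξ ω)) opt) else 0) ∂P +
        P {ω | cumReward (hist a rule t (env Y Z ξ ω)) opt ∈
          (G (pulls (hist a rule t (env Y Z ξ ω)) opt))ᶜ}) :=
        Finset.sum_le_sum fun t _ => hsplit t
    _ ≤ (0 + ENNReal.ofReal (boundConst a * L) + 1) +
          ∑ t ∈ Finset.range n, ∑ s ∈ Finset.range n, ((n ^ 2 : ℕ) : ℝ≥0∞)⁻¹ := by
        rw [Finset.sum_add_distrib]
        refine add_le_add ?_ (Finset.sum_le_sum fun t ht => ?_)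
        · exact (M.sum_lintegral_pull_le a rule opt hrm n).trans hthr
        · refine (M.measure_cumReward_le a rule opt (fun s => (hG s).compl)
            (Finset.mem_range.1 ht)).trans ?_
          exact Finset.sum_le_sum fun s _ => hbad s
    _ ≤ (0 + ENNReal.ofReal (boundConst a * L) + 1) + 1 := by
        gcongr
        simp only [Finset.sum_const, Finset.card_range, nsmul_eq_mul]
        rw [← mul_assoc, ← Nat.cast_mul, ← sq]
        exact ENNReal.mul_inv_le_one _
    _ = _ := by
        have e : 16 * a * boundConst a / d ^ 2 * Real.log n = boundConst a * L := by
          rw [hLdef]; ring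
        have : ENNReal.ofReal 2 = 2 := by simp
        rw [e, ENNReal.ofReal_add (by positivity) (by norm_num), this, zero_add, add_assoc]
        norm_num

end IsModel

end PHE

/-- The rewards `Y t i`, the pseudo-rewards `Z t i l` and the tie-breaking seed `ξ` are random
variables on a probability space. The reward vectors of different rounds are independent, and
`Y t i` has law `ν i`; the pseudo-rewards are i.i.d. `Ber(1/2)`; and rewards, pseudo-rewards and seed
are independent of each other. -/
theorem theorem2 {K : ℕ} {Ω S : Type*} [MeasurableSpace Ω] [MeasurableSpace S]
    (P : MeasureTheory.Measure Ω) [MeasureTheory.IsProbabilityMeasure P]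
    -- the bandit: reward distributions supported in `[0, 1]`, with a unique optimal arm
    (ν : Fin K → MeasureTheory.Measure ℝ) [∀ i, MeasureTheory.IsProbabilityMeasure (ν i)]
    (hν : ∀ i, ∀ᵐ x ∂(ν i), x ∈ Set.Icc (0 : ℝ) 1)
    (opt : Fin K) (hopt : ∀ i, i ≠ opt → PHE.mean ν i < PHE.mean ν opt)
    -- the rewards
    (Y : ℕ → Fin K → Ω → ℝ) (hY : ∀ t i, Measurable (Y t i))
    (hYlaw : ∀ t i, P.map (Y t i) = ν i)
    (hYindep : ProbabilityTheory.iIndepFun (fun (t : ℕ) (ω : Ω) (i : Fin K) => Y t i ω) P)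
    -- the pseudo-rewards
    (Z : ℕ → Fin K → ℕ → Ω → ℝ) (hZ : ∀ t i l, Measurable (Z t i l))
    (hZlaw : ∀ t i l, P.map (Z t i l) = PHE.fairBernoulli)
    (hZindep : ProbabilityTheory.iIndepFun
      (fun (p : ℕ × Fin K × ℕ) (ω : Ω) => Z p.1 p.2.1 p.2.2 ω) P)
    (hYZ : ProbabilityTheory.IndepFun (fun ω t i => Y t i ω) (fun ω t i l => Z t i l ω) P)
    -- the choice among the maximizers, possibly randomized
    (rule : PHE.ArgmaxRule K S) (ξ : Ω → S) (hξ : Measurable ξ)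
    (hξYZ : ProbabilityTheory.IndepFun ξ
      (fun ω => ((fun t i => Y t i ω : ℕ → Fin K → ℝ),
        (fun t i l => Z t i l ω : ℕ → Fin K → ℕ → ℝ))) P)
    -- the perturbation scale and the number of rounds
    (a : ℕ) (ha : 2 < a) (n : ℕ) :
    PHE.regret P ν opt
        (fun t ω => PHE.arm a rule (ξ ω) (fun t i => Y t i ω) (fun t i l => Z t i l ω) t) n ≤
      ∑ i ∈ Finset.univ.erase opt, PHE.gap ν opt i *
        ((16 * a * PHE.boundConst a / PHE.gap ν opt i ^ 2 * Real.log n + 2) +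
          (8 * a / PHE.gap ν opt i ^ 2 * Real.log n + 3)) := by
  have M : PHE.IsModel P ν Y Z ξ :=
    ⟨hY, hYlaw, hYindep, hZ, hZlaw, hZindep, hYZ, hξ, hξYZ⟩
  unfold PHE.regret
  refine Finset.sum_le_sum fun i hi => ?_
  have hgap : 0 < PHE.gap ν opt i := sub_pos.2 (hopt i (Finset.ne_of_mem_erase hi))
  refine mul_le_mul_of_nonneg_left ?_ hgap.le
  set d := PHE.gap ν opt i with hd
  rcases Nat.eq_zero_or_pos n with rfl | hn
  · norm_num
  have hc := PHE.boundConst_nonneg a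
  have hlog : 0 ≤ Real.log n := Real.log_natCast_nonneg n
  have hE : ∀ t, MeasurableSet {ω | PHE.pulledArm a rule t (PHE.env Y Z ξ ω) = i} := fun t =>
    ((PHE.measurable_pulledArm a rule t).comp M.measurable_env) (measurableSet_singleton i)
  have hint : ∀ t, (fun ω => if PHE.arm a rule (ξ ω) (fun t i => Y t i ω) (fun t i l => Z t i l ω) t
      = i then (1 : ℝ) else 0) =
      {ω | PHE.pulledArm a rule t (PHE.env Y Z ξ ω) = i}.indicator 1 := fun t => by
    ext ω
    by_cases h : ω ∈ {ω | PHE.pulledArm a rule t (PHE.env Y Z ξ ω) = i}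
    · rw [Set.indicator_of_mem h]
      exact if_pos h
    · rw [Set.indicator_of_notMem h]
      exact if_neg h
  have hexp : ∫ ω, (∑ t ∈ Finset.range n, if PHE.arm a rule (ξ ω) (fun t i => Y t i ω)
      (fun t i l => Z t i l ω) t = i then (1 : ℝ) else 0) ∂P =
      (∑ t ∈ Finset.range n, P {ω | PHE.pulledArm a rule t (PHE.env Y Z ξ ω) = i}).toReal := by
    rw [MeasureTheory.integral_finsetSum,
      ENNReal.toReal_sum fun t _ => MeasureTheory.measure_ne_top _ _]
    · refine Finset.sum_congr rfl fun t _ => ?_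
      rw [hint t, MeasureTheory.integral_indicator_one (hE t)]
      rfl
    · intro t _
      rw [hint t]
      exact (MeasureTheory.integrable_const (1 : ℝ)).indicator (hE t)
  rw [hexp]
  refine ENNReal.toReal_le_of_le_ofReal (by positivity) ?_
  -- the two thresholds coincide: both are half-way between the means
  have hθ : PHE.mean ν opt - d / 2 = PHE.mean ν i + d / 2 := by
    rw [hd, PHE.gap]; ring
  have hbelow := M.sum_measure_below_le ha rule opt i (hν opt) hgap hn
  have habove := M.sum_measure_above_le ha rule i (hν i) hgap hn
  rw [hθ] at hbelow
  rw [ENNReal.ofReal_add (by positivity) (by positivity)]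
  refine le_trans ?_ (add_le_add hbelow habove)
  rw [← Finset.sum_add_distrib]
  refine Finset.sum_le_sum fun t _ => ?_
  refine le_trans (MeasureTheory.measure_mono fun ω hω => ?_) (MeasureTheory.measure_union_le _ _)
  rcases lt_or_ge (PHE.estimates a rule t (PHE.env Y Z ξ ω) i)
    (((PHE.mean ν i + d / 2 + a / 2) / (a + 1) : ℝ) : EReal) with h | h
  · exact Or.inl ⟨hω, h⟩
  · exact Or.inr ⟨hω, h⟩
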